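/- All graphs are finite, simple and undirected. For a graph $G$ and a set $S\subseteq V(G)$ with $|S|\ge 2$, an $S$-tree is a subgraph $T$ of $G$ that is a tree with $S\subseteq V(T)$; two $S$-trees $T,T'$ are internally disjoint if $E(T)\cap E(T')=\varnothing$ and $V(T)\cap V(T')=S$; and $\kappa(S)$ is the maximum number of pairwise internally disjoint $S$-trees in $G$. The generalized $3$-connectivity is $\kappa_3(G)=\min\{\kappa(S): S\subseteq V(G),\ |S|=3\}$ if $G$ is connected with at least three vertices; $\kappa_3(G)=1$ if $G$ is connected with fewer than three vertices, and $\kappa_3(G)=0$ if $G$ is disconnected. Let $\kappa(G)$ be the (vertex-)connectivity of $G$, i.e. the least number of vertices whose deletion leaves a disconnected graph or a graph with at most one vertex. The lexicographic product $G\circ H$ has vertex set $V(G)\times V(H)$, with distinct vertices $(u,v)$ and $(u',v')$ adjacent if and only if $uu'\in E(G)$, or $u=u'$ and $vv'\in E(H)$. **Theorem 1.10.** Let $G$ and $H$ be connected graphs, where $G$ is non-trivial (it has at least two vertices) and non-complete. Then $$\kappa_3(G\circ H)\le \left\lfloor \tfrac43\kappa_3(G)+r-\tfrac43\left\lceil \tfrac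 r2\right\rceil\right\rfloor |V(H)|,$$ where $r\in\{0,1,2,3\}$ and $r\equiv\kappa(G)\pmod 4$. Moreover, the bound is sharp: with $P_n$ denoting the path on $n$ vertices, equality holds for $G=P_n$ and $H=P_3$, for every $n\ge 4$ (and these graphs satisfy the hypotheses). -/

import Mathlib

namespace GenConn

/-- The lexicographic product `G ∘ H`: distinct `(u, v)` and `(u', v')` are adjacent iff
`u u' ∈ E(G)`, or `u = u'` and `v v' ∈ E(H)`. -/
def lexProd {V W : Type*} (G : SimpleGraph V) (H : SimpleGraph W) : SimpleGraph (V × W) where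
  Adj x y := G.Adj x.1 y.1 ∨ (x.1 = y.1 ∧ H.Adj x.2 y.2)
  symm := ⟨fun _ _ h => h.imp (fun a => a.symm) (fun a => ⟨a.1.symm, a.2.symm⟩)⟩
  loopless := ⟨fun _ h => h.elim (fun a => G.irrefl a) (fun a => H.irrefl a.2)⟩

/-- The (vertex-)connectivity `κ(G)` of a finite graph: the least number of vertices whose
deletion leaves a disconnected graph or a graph with at most one vertex. -/
noncomputable def connectivity {V : Type*} (G : SimpleGraph V) : ℕ :=
  sInf {k : ℕ | ∃ X : Finset V, X.card = k ∧
    (¬ (G.induce {v | v ∉ X}).Preconnected ∨ {v | v ∉ X}.Subsingleton)}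

/-- `T` is an `S`-tree (Steiner tree connecting `S`): a subgraph of `G` that is a tree and whose
vertex set contains `S`. -/
def IsSteinerTree {V : Type*} {G : SimpleGraph V} (S : Finset V) (T : G.Subgraph) : Prop :=
  T.coe.IsTree ∧ (S : Set V) ⊆ T.verts

/-- Two `S`-trees are internally disjoint if they share no edge and share exactly the vertices
in `S`. -/
def InternallyDisjoint {V : Type*} {G : SimpleGraph V} (S : Finset V) (T T' : G.Subgraph) : Prop :=
  T.edgeSet ∩ T'.edgeSet = ∅ ∧ T.verts ∩ T'.verts = (S : Set V)

/-- The generalized local connectivity `κ(S)`: the maximum number of (pairwise) internally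
disjoint `S`-trees in the finite graph `G`. -/
noncomputable def localConnectivity {V : Type*} (G : SimpleGraph V) (S : Finset V) : ℕ :=
  sSup {m : ℕ | ∃ F : Finset G.Subgraph, F.card = m ∧ (∀ T ∈ F, IsSteinerTree S T) ∧
    ∀ T ∈ F, ∀ T' ∈ F, T ≠ T' → InternallyDisjoint S T T'}

/-- The set whose supremum is `localConnectivity G S` is bounded in a finite graph, so that this
supremum is a maximum. -/
theorem bddAbove_localConnectivity {V : Type*} [Finite V] (G : SimpleGraph V) (S : Finset V) :
    BddAbove {m : ℕ | ∃ F : Finset G.Subgraph, F.card = m ∧ (∀ T ∈ F, IsSteinerTree S T) ∧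
      ∀ T ∈ F, ∀ T' ∈ F, T ≠ T' → InternallyDisjoint S T T'} := by
  have : Fintype G.Subgraph := Fintype.ofFinite _
  refine ⟨Fintype.card G.Subgraph, ?_⟩
  rintro m ⟨F, rfl, -⟩
  exact Finset.card_le_univ F

open Classical in
/-- The generalized `k`-connectivity `κ_k(G)` of a finite graph: the minimum of `κ(S)` over all
`k`-element sets `S` of vertices. By convention it is `0` if `G` is disconnected, and `1` if `G`
is connected with fewer than `k` vertices. -/
noncomputable def genConnectivity {V : Type*} (k : ℕ) (G : SimpleGraph V) : ℕ :=
  if ¬ G.Connected then 0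
  else if Nat.card V < k then 1
  else sInf {m : ℕ | ∃ S : Finset V, S.card = k ∧ localConnectivity G S = m}

end GenConn

/-! Both sides are compared with κ(G)·|V(H)|. For the upper half, a minimum vertex cut X of the
non-complete graph G gives the cut X × V(H) of the product. Whenever a cut of size k separates a
graph on at least three vertices, some triple has at most k internally disjoint trees
(`exists_localConnectivity_le_of_cut`). Hence κ₃(G ∘ H) ≤ κ(G)·|V(H)|.

The other half is κ₃(G) ≥ ⌊(3κ(G) + 1)/4⌋ (`IsHighlyConnected.le_localConnectivity`). Writing κ(G) =
4q + r, this reads κ₃(G) ≥ 3q + ⌈r/2⌉, and solving for κ(G) gives the floor expression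
(`le_floor_of_mod_four`).

For that lower bound with m = κ(G), subdivide the edges between the three terminals and replace each
terminal by m clones. Menger's theorem gives m disjoint paths between two clone classes. Augmenting
a linkage from the third class onto these paths, and splitting a path whenever it is hit twice,
produces disjoint connected sets (`exists_clusters`): c₁ of them meet all three classes and c₂ meet
each given pair, with c₁ + 2c₂ = m. Two sets of different pair types together connect the terminals,
so there are c₁ + ⌊3c₂/2⌋ trees, which is at least ⌊(3m + 1)/4⌋.

For sharpness, κ(Pₙ) = κ₃(Pₙ) = 1, so the bound is 3, and three trees are exhibited for every triple
of Pₙ ∘ P₃. -/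

namespace GenConn

/-! ### Paths as lists of vertices, and Menger's theorem with prescribed ends -/

/-- `l` lists the vertices of a path of `K` from `a` to `e`. -/
structure IsLink {κ : Type*} (K : SimpleGraph κ) (a e : κ) (l : List κ) : Prop where
  chain : l.IsChain K.Adj
  nodup : l.Nodup
  head : l.head? = some a
  last : l.getLast? = some e

namespace IsLink

variable {κ : Type*} {K : SimpleGraph κ} {a b e x y : κ} {l l₁ l₂ : List κ}

theorem singleton (a : κ) : IsLink K a a [a] := ⟨by simp, by simp, by simp, by simp⟩

theorem start_mem (h : IsLink K a e l) : a ∈ l := List.mem_of_head? h.head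

theorem end_mem (h : IsLink K a e l) : e ∈ l := List.mem_of_getLast? h.last

theorem append (h₁ : IsLink K a x l₁) (h₂ : IsLink K x e (x :: l₂)) (hd : List.Disjoint l₁ l₂) :
    IsLink K a e (l₁ ++ l₂) := by
  obtain ⟨c₁, n₁, s₁, t₁⟩ := h₁
  obtain ⟨c₂, n₂, -, t₂⟩ := h₂
  refine ⟨?_, ?_, ?_, ?_⟩
  · rw [List.isChain_append]
    refine ⟨c₁, c₂.tail, ?_⟩
    intro u hu v hv
    rw [t₁] at hu
    obtain rfl : x = u := by simpa using hu
    cases l₂ with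
    | nil => simp at hv
    | cons w l₂ =>
      obtain rfl : w = v := by simpa using hv
      simp only [List.isChain_cons_cons] at c₂
      exact c₂.1
  · rw [List.nodup_append']
    exact ⟨n₁, n₂.of_cons, hd⟩
  · simp [List.head?_append, s₁]
  · cases l₂ with
    | nil => simpa [t₁] using t₂
    | cons w l₂ => simpa [List.getLast?_append] using t₂

theorem left (h : IsLink K a e (l₁ ++ x :: l₂)) : IsLink K a x (l₁ ++ [x]) := by
  obtain ⟨c, n, s, t⟩ := h
  have hp : (l₁ ++ [x]) <+: (l₁ ++ x :: l₂) := ⟨l₂, by simp⟩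
  refine ⟨c.prefix hp, n.sublist hp.sublist, ?_, by simp⟩
  cases l₁ <;> simpa using s

theorem right (h : IsLink K a e (l₁ ++ x :: l₂)) : IsLink K x e (x :: l₂) := by
  obtain ⟨c, n, s, t⟩ := h
  have hp : (x :: l₂) <:+ (l₁ ++ x :: l₂) := ⟨l₁, rfl⟩
  refine ⟨c.suffix hp, n.sublist hp.sublist, by simp, ?_⟩
  simpa [List.getLast?_append] using t

theorem reverse (h : IsLink K a e l) : IsLink K e a l.reverse := by
  obtain ⟨c, n, s, t⟩ := h
  refine ⟨?_, by simpa using n, by simpa using t, by simpa using s⟩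
  rw [List.isChain_reverse]
  exact c.imp fun _ _ h => h.symm

theorem concat (h : IsLink K a b l) (hbe : K.Adj b e) (he : e ∉ l) : IsLink K a e (l ++ [e]) := by
  refine h.append (x := b) ⟨by simpa using hbe, by simpa using hbe.ne, by simp, by simp⟩ ?_
  simpa using he

end IsLink

theorem exists_isLink_of_reflTransGen {κ : Type*} {K : SimpleGraph κ} {P : κ → Prop} {a b : κ}
    (ha : P a) (h : Relation.ReflTransGen (fun u v => K.Adj u v ∧ P v) a b) :
    ∃ l, IsLink K a b l ∧ ∀ v ∈ l, P v := by
  induction h with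
  | refl => exact ⟨[a], .singleton a, by simpa using ha⟩
  | @tail b c _ hbc ih =>
    obtain ⟨l, hl, hP⟩ := ih
    by_cases hc : c ∈ l
    · obtain ⟨s, t, rfl⟩ := List.append_of_mem hc
      exact ⟨s ++ [c], hl.left, fun v hv => hP v (by simp at hv ⊢; tauto)⟩
    · refine ⟨l ++ [c], hl.concat hbc.1 hc, fun v hv => ?_⟩
      rcases List.mem_append.1 hv with hv | hv
      · exact hP v hv
      · obtain rfl : v = c := by simpa using hv
        exact hbc.2

theorem exists_first_of_mem {α : Type*} (P : α → Prop) (l : List α) (h : ∃ v ∈ l, P v) :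
    ∃ s x t, l = s ++ x :: t ∧ P x ∧ ∀ v ∈ s, ¬ P v := by
  induction l with
  | nil => simp at h
  | cons w l ih =>
    by_cases hw : P w
    · exact ⟨[], w, l, by simp, hw, by simp⟩
    · have : ∃ v ∈ l, P v := by
        obtain ⟨v, hv, hPv⟩ := h
        rcases List.mem_cons.1 hv with rfl | hv
        · exact absurd hPv hw
        · exact ⟨v, hv, hPv⟩
      obtain ⟨s, x, t, rfl, hx, hs⟩ := ih this
      exact ⟨w :: s, x, t, by simp, hx, by simpa using ⟨hw, hs⟩⟩

theorem exists_last_of_mem {α : Type*} (P : α → Prop) (l : List α) (h : ∃ v ∈ l, P v) :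
    ∃ s x t, l = s ++ x :: t ∧ P x ∧ ∀ v ∈ t, ¬ P v := by
  obtain ⟨s, x, t, h₁, h₂, h₃⟩ := exists_first_of_mem P l.reverse (by simpa using h)
  refine ⟨t.reverse, x, s.reverse, ?_, h₂, by simpa using h₃⟩
  rw [← List.reverse_reverse l, h₁]; simp

/-- The set `E ⊆ B` is the set of ends of a family of pairwise disjoint paths from `A` to `B`, each
of which meets `B` in its end only; `p e` is the path that ends in `e`. -/
structure IsLinkage {κ : Type*} (K : SimpleGraph κ) (A B E : Finset κ) (p : κ → List κ) :
    Prop where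
  subset : E ⊆ B
  link : ∀ e ∈ E, ∃ a ∈ A, IsLink K a e (p e)
  only : ∀ e ∈ E, ∀ v ∈ p e, v ∈ B → v = e
  disj : ∀ e ∈ E, ∀ e' ∈ E, e ≠ e' → List.Disjoint (p e) (p e')

/-- No set of fewer than `k` vertices separates `A` from `B`. -/
def Unseparated {κ : Type*} (K : SimpleGraph κ) (k : ℕ) (A B : Finset κ) : Prop :=
  ∀ C : Finset κ, C.card < k → ∃ a ∈ A, ∃ b ∈ B, ∃ l, IsLink K a b l ∧ ∀ v ∈ l, v ∉ C

theorem Unseparated.mono {κ : Type*} {K : SimpleGraph κ} {k : ℕ} {A B B' : Finset κ}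
    (h : Unseparated K k A B) (hB : B ⊆ B') : Unseparated K k A B' := fun C hC => by
  obtain ⟨a, ha, b, hb, l, hl⟩ := h C hC
  exact ⟨a, ha, b, hB hb, l, hl⟩

theorem IsLinkage.mono {κ : Type*} {K : SimpleGraph κ} {A B B' E E' : Finset κ} {p : κ → List κ}
    (h : IsLinkage K A B E p) (hB : B' ⊆ B) (hE : E' ⊆ E) (hEB : E' ⊆ B') :
    IsLinkage K A B' E' p :=
  ⟨hEB, fun e he => h.link e (hE he), fun e he v hv hvB => h.only e (hE he) v hv (hB hvB),
    fun e he e' he' => h.disj e (hE he) e' (hE he')⟩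

section Menger

variable {κ : Type*} [DecidableEq κ] {K : SimpleGraph κ}

theorem IsLinkage.insert {A B E : Finset κ} {p : κ → List κ}
    (h : IsLinkage K A B E p) {b : κ} {r : List κ} (hb : b ∈ B) (hbE : b ∉ E)
    (hr : ∃ a ∈ A, IsLink K a b r) (hrB : ∀ v ∈ r, v ∈ B → v = b)
    (hrp : ∀ e ∈ E, List.Disjoint (p e) r) :
    IsLinkage K A B (insert b E) (Function.update p b r) := by
  have hne : ∀ e ∈ E, e ≠ b := fun e he heb => hbE (heb ▸ he)
  constructor
  · exact Finset.insert_subset hb h.subset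
  · intro e he
    rcases Finset.mem_insert.1 he with rfl | he
    · simpa using hr
    · simpa [hne e he] using h.link e he
  · intro e he
    rcases Finset.mem_insert.1 he with rfl | he
    · simpa using hrB
    · simpa [hne e he] using h.only e he
  · intro e he e' he' hee
    rcases Finset.mem_insert.1 he with heb | hm <;> rcases Finset.mem_insert.1 he' with heb' | hm'
    · exact absurd (heb.trans heb'.symm) hee
    · subst heb
      simpa [hne e' hm'] using (hrp e' hm').symm
    · subst heb'
      simpa [hne e hm] using hrp e hm
    · simpa [hne e hm, hne e' hm'] using h.disj e hm e' hm' hee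

/-- Prolong two paths of a linkage to a larger set `B'` so that they end in `B`. -/
theorem IsLinkage.prolong {A B B' E : Finset κ} {q : κ → List κ} {x y e₁ e₂ : κ}
    {t₁ t₂ : List κ}
    (h : IsLinkage K A B' (Insert.insert x (Insert.insert y E)) q) (hxy : x ≠ y)
    (hBB : B ⊆ B') (hEB : E ⊆ B) (h₁B : e₁ ∈ B) (h₂B : e₂ ∈ B)
    (h₁ : IsLink K x e₁ (x :: t₁)) (h₂ : IsLink K y e₂ (y :: t₂))
    (ht₁ : ∀ v ∈ t₁, v ∈ B') (ht₂ : ∀ v ∈ t₂, v ∈ B')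
    (ht₁B : ∀ v ∈ x :: t₁, v ∈ B → v = e₁) (ht₂B : ∀ v ∈ y :: t₂, v ∈ B → v = e₂)
    (hyt₁ : y ∉ t₁) (hxt₂ : x ∉ t₂)
    (hE₁ : ∀ e ∈ E, e ∉ t₁) (hE₂ : ∀ e ∈ E, e ∉ t₂)
    (hE₁' : e₁ ∉ E) (hE₂' : e₂ ∉ E) (hxE : x ∉ E) (hyE : y ∉ E)
    (ht : List.Disjoint t₁ t₂) (hee : e₁ ≠ e₂) :
    ∃ p, IsLinkage K A B (Insert.insert e₁ (Insert.insert e₂ E)) p := by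
  have hE : IsLinkage K A B E q := h.mono hBB (fun v hv => by simp [hv]) hEB
  have hqx := h.only x (by simp)
  have hqy := h.only y (by simp)
  have hqE : ∀ e ∈ E, ∀ v ∈ q e, v ∈ B' → v = e := fun e he => h.only e (by simp [he])
  have hxt₁ : x ∉ t₁ := (List.nodup_cons.1 h₁.nodup).1
  have hyt₂ : y ∉ t₂ := (List.nodup_cons.1 h₂.nodup).1
  have dxy : List.Disjoint (q x) (q y) := h.disj x (by simp) y (by simp) hxy
  have dEx : ∀ e ∈ E, List.Disjoint (q e) (q x) := fun e he =>
    h.disj e (by simp [he]) x (by simp) (fun h => hxE (h ▸ he))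
  have dEy : ∀ e ∈ E, List.Disjoint (q e) (q y) := fun e he =>
    h.disj e (by simp [he]) y (by simp) (fun h => hyE (h ▸ he))
  have d₁ : List.Disjoint (q x) t₁ := fun v hv hv' => hxt₁ (hqx v hv (ht₁ v hv') ▸ hv')
  have d₂ : List.Disjoint (q y) t₂ := fun v hv hv' => hyt₂ (hqy v hv (ht₂ v hv') ▸ hv')
  have d₁₂ : List.Disjoint (q x) t₂ := fun v hv hv' => hxt₂ (hqx v hv (ht₂ v hv') ▸ hv')
  have d₂₁ : List.Disjoint (q y) t₁ := fun v hv hv' => hyt₁ (hqy v hv (ht₁ v hv') ▸ hv')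
  have dE₁ : ∀ e ∈ E, List.Disjoint (q e) t₁ := fun e he v hv hv' =>
    hE₁ e he (hqE e he v hv (ht₁ v hv') ▸ hv')
  have dE₂ : ∀ e ∈ E, List.Disjoint (q e) t₂ := fun e he v hv hv' =>
    hE₂ e he (hqE e he v hv (ht₂ v hv') ▸ hv')
  obtain ⟨a₁, ha₁, l₁⟩ := h.link x (by simp)
  obtain ⟨a₂, ha₂, l₂⟩ := h.link y (by simp)
  have s₂ := hE.insert (b := e₂) (r := q y ++ t₂) h₂B hE₂' ⟨a₂, ha₂, l₂.append h₂ d₂⟩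
    (by
      intro v hv hvB
      rcases List.mem_append.1 hv with hv | hv
      · exact ht₂B v (by simp [hqy v hv (hBB hvB)]) hvB
      · exact ht₂B v (by simp [hv]) hvB)
    (fun e he => List.disjoint_append_right.2 ⟨dEy e he, dE₂ e he⟩)
  refine ⟨_, s₂.insert (b := e₁) (r := q x ++ t₁) h₁B (by simp [hee, hE₁'])
    ⟨a₁, ha₁, l₁.append h₁ d₁⟩ ?_ ?_⟩
  · intro v hv hvB
    rcases List.mem_append.1 hv with hv | hv
    · exact ht₁B v (by simp [hqx v hv (hBB hvB)]) hvB
    · exact ht₁B v (by simp [hv]) hvB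
  · intro e he
    rcases Finset.mem_insert.1 he with rfl | he
    · simp only [Function.update_self, List.disjoint_append_right, List.disjoint_append_left]
      exact ⟨⟨dxy.symm, d₁₂.symm⟩, d₂₁, ht.symm⟩
    · have : e ≠ e₂ := fun h => hE₂' (h ▸ he)
      simp only [Function.update_of_ne this, List.disjoint_append_right]
      exact ⟨dEx e he, dE₁ e he⟩

/-- Menger's theorem in augmenting form: a linkage with fewer than `k` paths can be replaced by one
with an additional end. -/
theorem IsLinkage.augment [Fintype κ] {k : ℕ} {A : Finset κ} (n : ℕ) :
    ∀ {B E : Finset κ} {p : κ → List κ}, Bᶜ.card = n → IsLinkage K A B E p → E.card < k →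
      Unseparated K k A B → ∃ e ∈ B, e ∉ E ∧ ∃ q, IsLinkage K A B (Insert.insert e E) q := by
  induction n using Nat.strong_induction_on with
  | _ n ih =>
  intro B E p hn h hEk hsep
  obtain ⟨a, ha, b, hb, r, hr, hrE⟩ := hsep E hEk
  obtain ⟨r₁, b', r₂, rfl, hb', hr₁⟩ := exists_first_of_mem (· ∈ B) r ⟨b, hr.end_mem, hb⟩
  replace hrE : ∀ v ∈ r₁ ++ [b'], v ∉ E := fun v hv => hrE v (by simp at hv ⊢; tauto)
  replace hr := hr.left
  have hrB : ∀ v ∈ r₁ ++ [b'], v ∈ B → v = b' := by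
    intro v hv hvB
    rcases List.mem_append.1 hv with hv | hv
    · exact absurd hvB (hr₁ v hv)
    · simpa using hv
  clear hr₁ hb r₂ b
  generalize r₁ ++ [b'] = r at hr hrE hrB
  have hbE : b' ∉ E := hrE b' hr.end_mem
  -- If `r` misses every linkage path it is simply added. Otherwise the induction enlarges the
  -- target `B`.
  by_cases hR : ∃ v ∈ r, ∃ e ∈ E, v ∈ p e
  swap
  · push Not at hR
    exact ⟨b', hb', hbE, _, h.insert hb' hbE ⟨a, ha, hr⟩ hrB
      fun e he v hv hv' => hR v hv' e he hv⟩
  -- Beyond the last contact `x`, the tail of `r` is free of linkage paths, so from `x` there are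
  -- two disjoint ways into `B`: along `p e₀` to `e₀`, or along `r` to `b'`.
  obtain ⟨r₁, x, r₂, rfl, ⟨e₀, he₀, hxe₀⟩, hr₂⟩ := exists_last_of_mem _ r hR
  obtain ⟨p₁, p₂, hp⟩ := List.append_of_mem hxe₀
  have hxE : x ∉ E := hrE x (by simp)
  have hxB : x ∉ B := fun hx => hxE ((h.only e₀ he₀ x hxe₀ hx) ▸ he₀)
  have hr' := hr.right
  obtain ⟨a₀, ha₀, hl₀⟩ := h.link e₀ he₀
  have hnd := hl₀.nodup
  rw [hp] at hl₀ hnd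
  have hl₀' := hl₀.right
  have he₀B := h.subset he₀
  have hxe : x ≠ e₀ := fun h => hxE (h ▸ he₀)
  have hxb : x ≠ b' := fun h => hxB (h ▸ hb')
  have hxp₂ : x ∉ p₂ := (List.nodup_cons.1 hl₀'.nodup).1
  have hxr₂ : x ∉ r₂ := (List.nodup_cons.1 hr'.nodup).1
  have hbr₂ : b' ∈ r₂ := by simpa [hxb.symm] using hr'.end_mem
  have hep₂ : e₀ ∈ p₂ := by simpa [hxe.symm] using hl₀'.end_mem
  have hp₂e₀ : ∀ v ∈ p₂, v ∈ p e₀ := fun v hv => by rw [hp]; simp [hv]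
  have hp₂B : ∀ v ∈ p₂, v ∈ B → v = e₀ := fun v hv => h.only e₀ he₀ v (hp₂e₀ v hv)
  have hr₂B : ∀ v ∈ r₂, v ∈ B → v = b' := fun v hv => hrB v (by simp [hv])
  have hr₂p : ∀ e ∈ E, ∀ v ∈ r₂, v ∉ p e := fun e he v hv hv' => hr₂ v hv ⟨e, he, hv'⟩
  have hpr : List.Disjoint p₂ r₂ := fun v hv hv' => hr₂p e₀ he₀ v hv' (hp₂e₀ v hv)
  have hEr₂ : ∀ e ∈ E, e ∉ r₂ := fun e he hv => by
    obtain ⟨_, _, hl⟩ := h.link e he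
    exact hr₂p e he e hv hl.end_mem
  have hEp₂ : ∀ e ∈ E.erase e₀, e ∉ p₂ := fun e he hv =>
    (Finset.mem_erase.1 he).1 (hp₂B e hv (h.subset (Finset.mem_of_mem_erase he)))
  -- Both tails join the target, which grows strictly because `x ∉ B`. Cutting `p e₀` at `x` keeps
  -- the number of paths, so the induction hypothesis supplies one more end `y` in `B'`.
  set B' : Finset κ := B ∪ (x :: p₂).toFinset ∪ (x :: r₂).toFinset with hB'
  have hmem : ∀ v, v ∈ B' ↔ v ∈ B ∨ v = x ∨ v ∈ p₂ ∨ v ∈ r₂ := by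
    intro v; simp [hB']; tauto
  have hBB : B ⊆ B' := fun v hv => (hmem v).2 (.inl hv)
  have hxB' : x ∈ B' := (hmem x).2 (by simp)
  have hlt : B'ᶜ.card < n := by
    rw [← hn]
    refine Finset.card_lt_card ⟨Finset.compl_subset_compl.2 hBB, fun hc => ?_⟩
    have := hc (Finset.mem_compl.2 hxB)
    exact Finset.mem_compl.1 this hxB'
  have hxE' : x ∉ E.erase e₀ := fun hx => hxE (Finset.mem_of_mem_erase hx)
  have hne : ∀ e ∈ E.erase e₀, e ≠ e₀ ∧ e ∈ E := fun e he => Finset.mem_erase.1 he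
  have base : IsLinkage K A B' (E.erase e₀) p := by
    refine ⟨fun v hv => hBB (h.subset (hne v hv).2), fun e he => h.link e (hne e he).2, ?_,
      fun e he e' he' => h.disj e (hne e he).2 e' (hne e' he').2⟩
    intro e he v hv hvB
    have hd := h.disj e (hne e he).2 e₀ he₀ (hne e he).1
    rcases (hmem v).1 hvB with hv' | rfl | hv' | hv'
    · exact h.only e (hne e he).2 v hv hv'
    · exact (hd hv hxe₀).elim
    · exact (hd hv (hp₂e₀ v hv')).elim
    · exact (hr₂p e (hne e he).2 v hv' hv).elim
  have hp₁e₀ : ∀ v ∈ p₁ ++ [x], v ∈ p e₀ := fun v hv => by rw [hp]; simp at hv ⊢; tauto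
  have step := base.insert (b := x) (r := p₁ ++ [x]) hxB' hxE' ⟨a₀, ha₀, hl₀.left⟩
    (by
      intro v hv hvB
      rcases (hmem v).1 hvB with hv' | rfl | hv' | hv'
      · have := h.only e₀ he₀ v (hp₁e₀ v hv) hv'
        subst this
        rw [List.nodup_append'] at hnd
        rcases List.mem_append.1 hv with hv | hv
        · exact (hnd.2.2 hv (by simp [hep₂])).elim
        · simpa using hv
      · rfl
      · rw [List.nodup_append'] at hnd
        rcases List.mem_append.1 hv with hv | hv
        · exact (hnd.2.2 hv (by simp [hv'])).elim
        · simpa using hv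
      · exact (hr₂p e₀ he₀ v hv' (hp₁e₀ v hv)).elim)
    (fun e he v hv hv' => h.disj e (hne e he).2 e₀ he₀ (hne e he).1 hv (hp₁e₀ v hv'))
  have hcard : (Insert.insert x (E.erase e₀)).card = E.card := by
    rw [Finset.card_insert_of_notMem hxE', Finset.card_erase_add_one he₀]
  obtain ⟨y, hy, hyE, q, hq⟩ := ih _ hlt rfl step (by rw [hcard]; exact hEk) (hsep.mono hBB)
  rw [Finset.insert_comm] at hq
  simp only [Finset.mem_insert, not_or] at hyE
  have hEe : Insert.insert e₀ (E.erase e₀) = E := Finset.insert_erase he₀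
  have hbe₀ : b' ≠ e₀ := fun h => hbE (h ▸ he₀)
  have hbE' : b' ∉ E.erase e₀ := fun h => hbE (hne _ h).2
  have hEB : E.erase e₀ ⊆ B := fun v hv => h.subset (hne v hv).2
  -- If `y` lies on the tail towards `e₀`, the path ending in `y` follows it and the one ending in
  -- `x` takes the tail of `r`. Otherwise `x` keeps the way to `e₀`, and `y` either follows the tail
  -- of `r` or is already in `B`.
  by_cases hyp : y ∈ p₂
  · obtain ⟨s, t, rfl⟩ := List.append_of_mem hyp
    have hyr₂ : y ∉ r₂ := fun h => hpr hyp h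
    have := hq.prolong (e₁ := b') (e₂ := e₀) (t₁ := r₂) (t₂ := t) (Ne.symm hyE.1) hBB hEB hb' he₀B
      hr' (hl₀'.right (l₁ := x :: s)) (fun v hv => (hmem v).2 (by simp [hv]))
      (fun v hv => (hmem v).2 (by simp [hv]))
      (fun v hv hvB => by
        rcases List.mem_cons.1 hv with rfl | hv
        · exact absurd hvB hxB
        · exact hr₂B v hv hvB)
      (fun v hv => hp₂B v (by simp at hv ⊢; tauto))
      hyr₂ (fun h => hxp₂ (by simp [h]))
      (fun e he => hEr₂ e (hne e he).2)
      (fun e he hv => hEp₂ e he (by simp [hv])) hbE' (by simp) hxE' hyE.2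
      (fun v hv hv' => hpr (a := v) (by simp [hv']) hv) hbe₀
    rw [hEe] at this
    exact ⟨b', hb', hbE, this⟩
  · obtain ⟨f, t, hf, hfE, hl, htr, htB⟩ : ∃ f t, f ∈ B ∧ f ∉ E ∧ IsLink K y f (y :: t) ∧
        (∀ v ∈ t, v ∈ r₂) ∧ (∀ v ∈ y :: t, v ∈ B → v = f) := by
      by_cases hyr : y ∈ r₂
      · obtain ⟨s, t, rfl⟩ := List.append_of_mem hyr
        exact ⟨b', t, hb', hbE, hr'.right (l₁ := x :: s), fun v hv => by simp [hv],
          fun v hv => hr₂B v (by simp at hv ⊢; tauto)⟩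
      · have hyB : y ∈ B := by
          rcases (hmem y).1 hy with h | h | h | h
          · exact h
          · exact absurd h hyE.1
          · exact absurd h hyp
          · exact absurd h hyr
        refine ⟨y, [], hyB, fun hyE' => ?_, .singleton y, by simp, by simp⟩
        exact hyE.2 (Finset.mem_erase.2 ⟨fun h => hyp (h ▸ hep₂), hyE'⟩)
    have hfe : e₀ ≠ f := fun h => hfE (h ▸ he₀)
    have := hq.prolong (e₁ := e₀) (e₂ := f) (t₁ := p₂) (t₂ := t) (Ne.symm hyE.1) hBB hEB he₀B hf
      hl₀' hl (fun v hv => (hmem v).2 (by simp [hv]))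
      (fun v hv => (hmem v).2 (by simp [htr v hv]))
      (fun v hv hvB => by
        rcases List.mem_cons.1 hv with rfl | hv
        · exact absurd hvB hxB
        · exact hp₂B v hv hvB)
      htB hyp (fun h => hxr₂ (htr x h)) hEp₂
      (fun e he hv => hEr₂ e (hne e he).2 (htr e hv)) (by simp) (fun h => hfE (hne _ h).2) hxE'
      hyE.2 (fun v hv hv' => hpr hv (htr v hv')) hfe
    rw [Finset.insert_comm, hEe] at this
    exact ⟨f, hf, hfE, this⟩

end Menger

/-! ### Linking three sets of equal size -/

section ThreeSets

variable {κ : Type*} [DecidableEq κ] {K : SimpleGraph κ}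

theorem exists_isLinkage_card [Fintype κ] {k : ℕ} {A B : Finset κ} (h : Unseparated K k A B) :
    ∀ j ≤ k, ∃ E p, E.card = j ∧ IsLinkage K A B E p := by
  intro j
  induction j with
  | zero => exact fun _ => ⟨∅, fun _ => [], by simp, by simp, by simp, by simp, by simp⟩
  | succ j ih =>
    intro hj
    obtain ⟨E, p, hE, hp⟩ := ih (by omega)
    obtain ⟨e, -, he, q, hq⟩ := hp.augment _ rfl (by omega) h
    exact ⟨_, q, by rw [Finset.card_insert_of_notMem he, hE], hq⟩

/-- `U` is the vertex set of an `X`-`Y` path with at most one marked vertex, or of a path from `X`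
and a path from `Y` that are disjoint and whose ends are the marked vertices.
The marked vertices form the set `F`. -/
def IsPiece (K : SimpleGraph κ) (X Y U F : Finset κ) : Prop :=
  (∃ x ∈ X, ∃ y ∈ Y, ∃ l, IsLink K x y l ∧ U = l.toFinset ∧ F ⊆ U ∧ F.card ≤ 1) ∨
  (∃ x ∈ X, ∃ y ∈ Y, ∃ u v l l', IsLink K x u l ∧ IsLink K y v l' ∧ List.Disjoint l l' ∧
    U = l.toFinset ∪ l'.toFinset ∧ F = {u, v})

theorem IsPiece.subset {X Y U F : Finset κ} (h : IsPiece K X Y U F) : F ⊆ U := by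
  rcases h with ⟨x, -, y, -, l, -, -, h, -⟩ | ⟨x, -, y, -, u, v, l, l', hl, hl', -, rfl, rfl⟩
  · exact h
  · intro w hw
    rcases Finset.mem_insert.1 hw with rfl | hw
    · simp [hl.end_mem]
    · obtain rfl := Finset.mem_singleton.1 hw
      simp [hl'.end_mem]

theorem IsPiece.exists_mem {X Y U F : Finset κ} (h : IsPiece K X Y U F) : ∃ x ∈ X, x ∈ U := by
  rcases h with ⟨x, hx, y, -, l, hl, rfl, -⟩ | ⟨x, hx, y, -, u, v, l, l', hl, -, -, rfl, -⟩
  · exact ⟨x, hx, by simp [hl.start_mem]⟩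
  · exact ⟨x, hx, by simp [hl.start_mem]⟩

theorem IsPiece.swap {X Y U F : Finset κ} (h : IsPiece K X Y U F) : IsPiece K Y X U F := by
  rcases h with ⟨x, hx, y, hy, l, hl, rfl, h⟩ | ⟨x, hx, y, hy, u, v, l, l', hl, hl', hd, rfl, rfl⟩
  · exact .inl ⟨y, hy, x, hx, l.reverse, hl.reverse, by simp, h⟩
  · exact .inr ⟨y, hy, x, hx, v, u, l', l, hl', hl, hd.symm, Finset.union_comm _ _,
      Finset.pair_comm _ _⟩

/-- The vertices strictly between `u` and `v` are dropped; the two remaining ends of the path are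
the rays. -/
theorem IsPiece.split {X Y : Finset κ} {x y u v : κ} {l : List κ} (hx : x ∈ X) (hy : y ∈ Y)
    (h : IsLink K x y l) (huv : ∃ s t w, l = s ++ u :: t ++ v :: w) :
    ∃ U ⊆ l.toFinset, IsPiece K X Y U {u, v} := by
  obtain ⟨s, t, w, rfl⟩ := huv
  have h₁ : IsLink K x u (s ++ [u]) := IsLink.left (l₂ := t ++ v :: w) (by simpa using h)
  have h₂ : IsLink K y v (v :: w).reverse := h.right.reverse
  refine ⟨(s ++ [u]).toFinset ∪ (v :: w).reverse.toFinset, ?_,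
    .inr ⟨x, hx, y, hy, u, v, _, _, h₁, h₂, ?_, rfl, rfl⟩⟩
  · intro a ha
    simp at ha ⊢
    tauto
  · have hn := (List.nodup_append'.1 h.nodup).2.2
    intro a ha ha'
    refine hn (a := a) ?_ (by simpa [or_comm] using ha')
    simp at ha ⊢
    tauto

/-- The ray is cut off at `e`. It loses its old end `u`, whence the strict inclusion. -/
theorem IsPiece.shorten {X Y : Finset κ} {x y u v e : κ} {l l' : List κ} (hx : x ∈ X) (hy : y ∈ Y)
    (h : IsLink K x u l) (h' : IsLink K y v l') (hd : List.Disjoint l l') (he : e ∈ l)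
    (heu : e ≠ u) :
    ∃ U ⊂ l.toFinset ∪ l'.toFinset, IsPiece K X Y U {e, v} := by
  obtain ⟨s, t, rfl⟩ := List.append_of_mem he
  have hut : u ∈ t := by simpa [heu.symm] using h.right.end_mem
  have hn := List.nodup_append'.1 h.nodup
  refine ⟨(s ++ [e]).toFinset ∪ l'.toFinset, ?_,
    .inr ⟨x, hx, y, hy, e, v, _, _, h.left, h', ?_, rfl, rfl⟩⟩
  · rw [Finset.ssubset_iff_of_subset]
    · refine ⟨u, by simp [hut], ?_⟩
      have h₁ : u ∉ s := fun hu => hn.2.2 hu (by simp [hut])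
      have h₂ : u ∉ l' := fun hu => hd (a := u) (by simp [hut]) hu
      simp [h₁, h₂, heu.symm]
    · intro a ha
      simp at ha ⊢
      tauto
  · intro a ha
    exact hd (by simp at ha ⊢; tauto)

/-- A new linkage end on an unmarked path marks it, on a path with one mark splits it, and on a ray
replaces the mark of that ray. Only the last case gains no mark, but there the piece shrinks. -/
theorem IsPiece.step {X Y U F : Finset κ} (h : IsPiece K X Y U F) {e : κ} (heU : e ∈ U)
    (heF : e ∉ F) : ∃ U' ⊆ U, ∃ F' ⊆ insert e F, IsPiece K X Y U' F' ∧
      (F'.card = F.card + 1 ∨ (F'.card = F.card ∧ U'.card < U.card)) := by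
  rcases h with ⟨x, hx, y, hy, l, hl, rfl, hF, hc⟩ |
    ⟨x, hx, y, hy, u, v, l, l', hl, hl', hd, rfl, rfl⟩
  · rcases Nat.le_one_iff_eq_zero_or_eq_one.1 hc with hc | hc
    · obtain rfl := Finset.card_eq_zero.1 hc
      exact ⟨_, subset_rfl, {e}, by simp, .inl ⟨x, hx, y, hy, l, hl, rfl, by simpa using heU,
        by simp⟩, by simp⟩
    · obtain ⟨u, rfl⟩ := Finset.card_eq_one.1 hc
      have heu : e ≠ u := by simpa using heF
      have hu : u ∈ l := by simpa using hF
      have he : e ∈ l := by simpa using heU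
      obtain ⟨s, t, rfl⟩ := List.append_of_mem he
      rcases List.mem_append.1 hu with hu | hu
      · obtain ⟨s, s', rfl⟩ := List.append_of_mem hu
        obtain ⟨U', hU', hp⟩ := IsPiece.split hx hy hl ⟨s, s', t, rfl⟩
        exact ⟨U', hU', _, (Finset.pair_comm u e).subset, hp,
          .inl (by rw [Finset.card_pair heu.symm]; simp)⟩
      · have hu : u ∈ t := by simpa [heu.symm] using hu
        obtain ⟨t, t', rfl⟩ := List.append_of_mem hu
        obtain ⟨U', hU', hp⟩ := IsPiece.split (u := e) (v := u) hx hy hl ⟨s, t, t', by simp⟩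
        exact ⟨U', hU', _, subset_rfl, hp, .inl (by rw [Finset.card_pair heu]; simp)⟩
  · simp only [Finset.mem_insert, Finset.mem_singleton, not_or] at heF
    have huv : u ≠ v := fun h => hd hl.end_mem (h ▸ hl'.end_mem)
    rcases Finset.mem_union.1 heU with he | he
    · obtain ⟨U', hU', hp⟩ := IsPiece.shorten hx hy hl hl' hd (by simpa using he) heF.1
      refine ⟨U', hU'.subset, _, ?_, hp, .inr ⟨?_, Finset.card_lt_card hU'⟩⟩
      · intro a ha; simp at ha ⊢; tauto
      · rw [Finset.card_pair heF.2, Finset.card_pair huv]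
    · obtain ⟨U', hU', hp⟩ := IsPiece.shorten hy hx hl' hl hd.symm (by simpa using he) heF.2
      rw [Finset.union_comm] at hU'
      refine ⟨U', hU'.subset, _, ?_, hp.swap, .inr ⟨?_, Finset.card_lt_card hU'⟩⟩
      · intro a ha; simp at ha ⊢; tauto
      · rw [Finset.card_pair heF.1, Finset.card_pair huv]

/-- Disjoint pieces, together with disjoint paths from `Z` that end in the marked vertices. -/
structure IsPieceSystem {m : ℕ} (K : SimpleGraph κ) (X Y Z : Finset κ) (U F : Fin m → Finset κ)
    (p : κ → List κ) : Prop where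
  piece : ∀ i, IsPiece K X Y (U i) (F i)
  disj : ∀ i j, i ≠ j → Disjoint (U i) (U j)
  linkage : IsLinkage K Z (Finset.univ.biUnion U) (Finset.univ.biUnion F) p

theorem exists_isPieceSystem [Fintype κ] {m : ℕ} {X Y : Finset κ} (Z : Finset κ)
    (h : Unseparated K m X Y) : ∃ (U : Fin m → Finset κ) (p : κ → List κ),
      IsPieceSystem K X Y Z U (fun _ => ∅) p := by
  obtain ⟨E, q, hE, hq⟩ := exists_isLinkage_card h m le_rfl
  let f : Fin m ≃ E := (finCongr hE.symm).trans E.equivFin.symm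
  refine ⟨fun i => (q (f i)).toFinset, fun _ => [], ?_, ?_, ?_⟩
  · intro i
    obtain ⟨x, hx, hl⟩ := hq.link (f i) (f i).2
    exact .inl ⟨x, hx, f i, hq.subset (f i).2, _, hl, rfl, by simp, by simp⟩
  · intro i j hij
    have : ((f i : E) : κ) ≠ f j := fun h => hij (f.injective (Subtype.ext h))
    have := hq.disj _ (f i).2 _ (f j).2 this
    rw [Finset.disjoint_left]
    intro a ha hb
    exact this (by simpa using ha) (by simpa using hb)
  · constructor <;> simp

namespace IsPieceSystem

variable {m : ℕ} {X Y Z : Finset κ} {U F : Fin m → Finset κ} {p : κ → List κ}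

theorem card_biUnion (h : IsPieceSystem K X Y Z U F p) :
    (Finset.univ.biUnion F).card = ∑ i, (F i).card :=
  Finset.card_biUnion fun i _ j _ hij =>
    (h.disj i j hij).mono (h.piece i).subset (h.piece j).subset

/-- The `m` disjoint pieces each contain a vertex of `X`, and `X` has only `m`. This lets the
unseparatedness of `Z` from `X` pass to `Z` and the union of the pieces. -/
theorem subset_biUnion (h : IsPieceSystem K X Y Z U F p) (hX : X.card = m) :
    X ⊆ Finset.univ.biUnion U := by
  choose x hx hxU using fun i => (h.piece i).exists_mem
  have hinj : Function.Injective x := by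
    intro i j hij
    by_contra hne
    exact Finset.disjoint_left.1 (h.disj i j hne) (hxU i) (hij ▸ hxU j)
  have : Finset.univ.image x = X := by
    apply Finset.eq_of_subset_of_card_le
    · intro a ha
      obtain ⟨i, -, rfl⟩ := Finset.mem_image.1 ha
      exact hx i
    · rw [Finset.card_image_of_injective _ hinj, hX]; simp
  intro a ha
  rw [← this] at ha
  obtain ⟨i, -, rfl⟩ := Finset.mem_image.1 ha
  exact Finset.mem_biUnion.2 ⟨i, Finset.mem_univ _, hxU i⟩

/-- Augmentation preserves the old ends and adds one, so exactly one piece has to be modified. When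
a mark is discarded, its linkage path is discarded as well. -/
theorem step [Fintype κ] (h : IsPieceSystem K X Y Z U F p) (hX : X.card = m)
    (hZ : Unseparated K m Z X) (hlt : ∑ i, (F i).card < m) :
    ∃ (U' F' : Fin m → Finset κ) (p' : κ → List κ), IsPieceSystem K X Y Z U' F' p' ∧
      ∃ i, U' i ⊆ U i ∧ (∀ j ≠ i, U' j = U j ∧ F' j = F j) ∧
      ((F' i).card = (F i).card + 1 ∨
        ((F' i).card = (F i).card ∧ (U' i).card < (U i).card)) := by
  obtain ⟨e, heB, heE, q, hq⟩ := h.linkage.augment _ rfl (by rwa [h.card_biUnion])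
    (hZ.mono (h.subset_biUnion hX))
  obtain ⟨i, -, hei⟩ := Finset.mem_biUnion.1 heB
  have heF : e ∉ F i := fun he => heE (Finset.mem_biUnion.2 ⟨i, Finset.mem_univ _, he⟩)
  obtain ⟨Ui, hUi, Fi, hFi, hp, hc⟩ := (h.piece i).step hei heF
  have hU : ∀ j, Function.update U i Ui j ⊆ U j := by
    intro j
    by_cases hj : j = i
    · subst hj; simpa using hUi
    · simp [hj]
  refine ⟨Function.update U i Ui, Function.update F i Fi, q, ⟨?_, ?_, ?_⟩, i, by simpa using hUi,
    fun j hj => by simp [hj], by simpa using hc⟩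
  · intro j
    by_cases hj : j = i
    · subst hj; simpa using hp
    · simpa [hj] using h.piece j
  · exact fun j k hjk => (h.disj j k hjk).mono (hU j) (hU k)
  · refine hq.mono (Finset.biUnion_mono fun j _ => hU j) ?_ ?_
    · intro a ha
      obtain ⟨j, -, ha⟩ := Finset.mem_biUnion.1 ha
      by_cases hj : j = i
      · subst hj
        rw [Function.update_self] at ha
        rcases Finset.mem_insert.1 (hFi ha) with rfl | ha
        · simp
        · exact Finset.mem_insert_of_mem (Finset.mem_biUnion.2 ⟨j, Finset.mem_univ _, ha⟩)
      · rw [Function.update_of_ne hj] at ha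
        exact Finset.mem_insert_of_mem (Finset.mem_biUnion.2 ⟨j, Finset.mem_univ _, ha⟩)
    · refine Finset.biUnion_mono fun j _ => ?_
      by_cases hj : j = i
      · subst hj; simpa using hp.subset
      · simpa [hj] using (h.piece j).subset

theorem exists_saturated [Fintype κ] (hX : X.card = m) (hXY : Unseparated K m X Y)
    (hZ : Unseparated K m Z X) : ∃ (U F : Fin m → Finset κ) (p : κ → List κ),
      IsPieceSystem K X Y Z U F p ∧ ∑ i, (F i).card = m := by
  -- The measure falls at each step: pieces never grow, and either the number of missing marks drops
  -- or a piece shrinks.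
  have key : ∀ n : ℕ, ∀ (U F : Fin m → Finset κ) (p : κ → List κ), IsPieceSystem K X Y Z U F p →
      ∑ i, (F i).card ≤ m →
      (m - ∑ i, (F i).card) * (Fintype.card κ + 1) + ∑ i, (U i).card = n →
      ∃ (U F : Fin m → Finset κ) (p : κ → List κ),
        IsPieceSystem K X Y Z U F p ∧ ∑ i, (F i).card = m := by
    intro n
    induction n using Nat.strong_induction_on with
    | _ n ih =>
    intro U F p h hle hn
    rcases hle.eq_or_lt with heq | hlt
    · exact ⟨U, F, p, h, heq⟩
    obtain ⟨U', F', p', h', i, hUi, hj, hc⟩ := h.step hX hZ hlt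
    have hsum : ∀ G G' : Fin m → Finset κ, (∀ j ≠ i, G' j = G j) →
        ∑ j, (G' j).card + (G i).card = ∑ j, (G j).card + (G' i).card := by
      intro G G' hG
      rw [← Finset.add_sum_erase _ _ (Finset.mem_univ i),
        ← Finset.add_sum_erase _ (fun j => (G j).card) (Finset.mem_univ i),
        Finset.sum_congr rfl fun j hj => by rw [hG j (Finset.ne_of_mem_erase hj)]]
      ring
    have h₁ := hsum U U' fun j hji => (hj j hji).1
    have h₂ := hsum F F' fun j hji => (hj j hji).2
    have h₃ := Finset.card_le_card hUi
    refine ih _ ?_ U' F' p' h' (by omega) rfl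
    rw [← hn]
    rcases hc with hc | ⟨hc, hc'⟩
    · have : m - ∑ i, (F i).card = (m - ∑ i, (F' i).card) + 1 := by omega
      rw [this, add_mul]
      omega
    · have : ∑ i, (F' i).card = ∑ i, (F i).card := by omega
      rw [this]
      omega
  obtain ⟨U, p, h⟩ := exists_isPieceSystem (K := K) Z hXY
  exact key _ U _ p h (by simp) rfl

end IsPieceSystem

end ThreeSets

/-! ### Connected vertex sets built from linkages. -/

/-- Any two vertices of `W` are joined by a walk within `W`. -/
def Clustered {κ : Type*} (K : SimpleGraph κ) (W : Finset κ) : Prop :=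
  ∀ a ∈ W, ∀ b ∈ W, Relation.ReflTransGen (fun u v => K.Adj u v ∧ u ∈ W ∧ v ∈ W) a b

theorem clustered_of_root {κ : Type*} {K : SimpleGraph κ} {W : Finset κ} (c : κ)
    (h : ∀ a ∈ W, Relation.ReflTransGen (fun u v => K.Adj u v ∧ u ∈ W ∧ v ∈ W) a c) :
    Clustered K W := fun a ha b hb => (h a ha).trans <| by
  have := (h b hb).swap
  exact Relation.ReflTransGen.mono (fun u v huv => ⟨huv.1.symm, huv.2.2, huv.2.1⟩) _ _ this

theorem reflTransGen_of_isChain {κ : Type*} {r : κ → κ → Prop} {P : κ → Prop} {l : List κ} :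
    ∀ a, P a → (a :: l).IsChain r → (∀ v ∈ l, P v) → ∀ v ∈ a :: l,
      Relation.ReflTransGen (fun u v => r u v ∧ P u ∧ P v) a v := by
  induction l with
  | nil => simp [Relation.ReflTransGen.refl]
  | cons b l ih =>
    intro a ha hc hP v hv
    rcases List.mem_cons.1 hv with rfl | hv
    · exact .refl
    · simp only [List.isChain_cons_cons] at hc
      have hb := hP b (by simp)
      exact .head ⟨hc.1, ha, hb⟩ (ih b hb hc.2 (fun v hv => hP v (by simp [hv])) v hv)

section

variable {κ : Type*} [DecidableEq κ] {K : SimpleGraph κ}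

theorem IsLink.clustered {a e : κ} {l : List κ} (h : IsLink K a e l) :
    Clustered K l.toFinset := by
  obtain ⟨c, -, s, -⟩ := h
  cases l with
  | nil => simp at s
  | cons b l =>
    obtain rfl : b = a := by simpa using s
    refine clustered_of_root b fun v hv => ?_
    have := reflTransGen_of_isChain (P := (· ∈ (b :: l).toFinset)) b (by simp) c
      (by simp +contextual) v (by simpa using hv)
    exact Relation.ReflTransGen.mono (fun u v huv => ⟨huv.1.symm, huv.2.2, huv.2.1⟩) _ _ this.swap

theorem Clustered.union_biUnion {W H : Finset κ} {p : κ → Finset κ} (hW : Clustered K W)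
    (hH : H ⊆ W) (hp : ∀ e ∈ H, Clustered K (p e)) (hep : ∀ e ∈ H, e ∈ p e) :
    Clustered K (W ∪ H.biUnion p) := by
  by_cases hne : W.Nonempty
  · obtain ⟨c, hc⟩ := hne
    refine clustered_of_root c fun a ha => ?_
    have h₁ : ∀ a ∈ W, Relation.ReflTransGen
        (fun u v => K.Adj u v ∧ u ∈ W ∪ H.biUnion p ∧ v ∈ W ∪ H.biUnion p) a c := fun a ha =>
      Relation.ReflTransGen.mono (fun u v h =>
        ⟨h.1, Finset.mem_union_left _ h.2.1, Finset.mem_union_left _ h.2.2⟩) _ _ (hW a ha c hc)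
    rcases Finset.mem_union.1 ha with ha | ha
    · exact h₁ a ha
    · obtain ⟨e, he, ha⟩ := Finset.mem_biUnion.1 ha
      have hsub : p e ⊆ W ∪ H.biUnion p :=
        (Finset.subset_biUnion_of_mem p he).trans Finset.subset_union_right
      exact Relation.ReflTransGen.trans (Relation.ReflTransGen.mono
        (fun u v h => ⟨h.1, hsub h.2.1, hsub h.2.2⟩) _ _ (hp e he a ha e (hep e he)))
        (h₁ e (hH he))
  · rw [Finset.not_nonempty_iff_eq_empty] at hne
    subst hne
    obtain rfl := Finset.subset_empty.1 hH
    simpa using hW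

/-- Three sets of `m` vertices, the first and second and the third and first of which cannot be
separated by fewer than `m` vertices, admit disjoint connected sets: `c₁` of them meet all three,
and `c₂` of them meet any given two of the three, where `c₁ + 2 c₂ = m`. -/
theorem exists_clusters [Fintype κ] {m : ℕ} (T : Fin 3 → Finset κ) (hT : (T 0).card = m)
    (h₁ : Unseparated K m (T 0) (T 1)) (h₂ : Unseparated K m (T 2) (T 0)) :
    ∃ c₁ c₂ : ℕ, c₁ + 2 * c₂ = m ∧ ∃ W : Fin c₁ ⊕ (Fin c₂ × Fin 3) → Finset κ,
      Pairwise (fun i j => Disjoint (W i) (W j)) ∧ (∀ i, Clustered K (W i)) ∧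
      (∀ i d, ∃ v ∈ T d, v ∈ W (.inl i)) ∧
      ∀ j c d, d ≠ c → ∃ v ∈ T d, v ∈ W (.inr (j, c)) := by
  obtain ⟨U, F, p, h, hsum⟩ := IsPieceSystem.exists_saturated hT h₁ h₂
  set I : ℕ → Finset (Fin m) := fun k => Finset.univ.filter fun i => (F i).card = k with hI
  have hle : ∀ i, (F i).card ≤ 2 := fun i => by
    rcases h.piece i with ⟨x, -, y, -, l, -, -, -, hc⟩ | ⟨x, -, y, -, u, v, l, l', -, -, -, -, hF⟩
    · omega
    · rw [hF]; exact Finset.card_le_two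
  have hcount : (I 0).card + (I 1).card + (I 2).card = m ∧
      (I 1).card + 2 * (I 2).card = ∑ i, (F i).card := by
    have e₁ : ∀ i, (if (F i).card = 0 then 1 else 0) + (if (F i).card = 1 then 1 else 0) +
        (if (F i).card = 2 then 1 else 0) = 1 := fun i => by
      have := hle i
      interval_cases (F i).card <;> simp
    have e₂ : ∀ i, (if (F i).card = 1 then 1 else 0) + 2 * (if (F i).card = 2 then 1 else 0) =
        (F i).card := fun i => by
      have := hle i
      interval_cases (F i).card <;> simp
    simp only [hI, Finset.card_filter]
    constructor
    · rw [← Finset.sum_add_distrib, ← Finset.sum_add_distrib, Finset.sum_congr rfl fun i _ => e₁ i]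
      simp
    · rw [Finset.mul_sum, ← Finset.sum_add_distrib, Finset.sum_congr rfl fun i _ => e₂ i]
  -- There are `m` pieces and `m` marks, each piece having at most two, so unmarked and doubly
  -- marked pieces are equally many and can be matched.
  have hc₀ : (I 0).card = (I 2).card := by omega
  let f₁ : Fin (I 1).card ≃ I 1 := (I 1).equivFin.symm
  let f₀ : Fin (I 2).card ≃ I 0 := (finCongr hc₀.symm).trans (I 0).equivFin.symm
  let f₂ : Fin (I 2).card ≃ I 2 := (I 2).equivFin.symm
  have hf₀ : ∀ j, (F (f₀ j)).card = 0 := fun j => (Finset.mem_filter.1 (f₀ j).2).2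
  have hf₁ : ∀ j, (F (f₁ j)).card = 1 := fun j => (Finset.mem_filter.1 (f₁ j).2).2
  have hf₂ : ∀ j, (F (f₂ j)).card = 2 := fun j => (Finset.mem_filter.1 (f₂ j).2).2
  have hpath : ∀ i, (F i).card ≠ 2 → ∃ x ∈ T 0, ∃ y ∈ T 1, ∃ l, IsLink K x y l ∧
      U i = l.toFinset := fun i hi => by
    rcases h.piece i with ⟨x, hx, y, hy, l, hl, hU, -⟩ |
      ⟨x, -, y, -, u, v, l, l', hl, hl', hd, -, hF⟩
    · exact ⟨x, hx, y, hy, l, hl, hU⟩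
    · refine absurd ?_ hi
      rw [hF, Finset.card_pair fun huv : u = v => hd hl.end_mem (huv ▸ hl'.end_mem)]
  have hrays : ∀ j, ∃ B : Fin 2 → Finset κ, ∃ u : Fin 2 → κ, (∀ d, B d ⊆ U (f₂ j)) ∧
      Disjoint (B 0) (B 1) ∧ (∀ d, u d ∈ B d ∧ u d ∈ F (f₂ j)) ∧ (∀ d, Clustered K (B d)) ∧
      (∃ v ∈ T 0, v ∈ B 0) ∧ ∃ v ∈ T 1, v ∈ B 1 := fun j => by
    rcases h.piece (f₂ j) with ⟨x, -, y, -, l, -, -, -, hc⟩ |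
      ⟨x, hx, y, hy, u, v, l, l', hl, hl', hd, hU, hF⟩
    · exact absurd (hf₂ j) (by omega)
    · refine ⟨![l.toFinset, l'.toFinset], ![u, v], ?_, ?_, ?_, ?_, ⟨x, hx, ?_⟩, y, hy, ?_⟩
      · simp [Fin.forall_fin_two, hU, Finset.subset_union_left, Finset.subset_union_right]
      · rw [Finset.disjoint_left]
        intro a ha ha'
        exact hd (by simpa using ha) (by simpa using ha')
      · simp [Fin.forall_fin_two, hF, hl.end_mem, hl'.end_mem]
      · simp [Fin.forall_fin_two, hl.clustered, hl'.clustered]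
      · simpa using hl.start_mem
      · simpa using hl'.start_mem
  choose B u hBU hBd huB hBc hB0 hB1 using hrays
  -- the index of the piece that contains a cluster, the part within the piece, and the marks
  let idx : Fin (I 1).card ⊕ (Fin (I 2).card × Fin 3) → Fin m :=
    Sum.elim (fun j => f₁ j) fun q => if q.2 = 2 then f₀ q.1 else f₂ q.1
  -- The second index names the class not required to be met: an unmarked path joins `T 0` to `T 1`
  -- (index 2), and the two rays of a split path, with their linkage paths, join `T 0` (index 1) and
  -- `T 1` (index 0) to `T 2`.
  let base : Fin (I 1).card ⊕ (Fin (I 2).card × Fin 3) → Finset κ :=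
    Sum.elim (fun j => U (f₁ j))
      fun q => if q.2 = 2 then U (f₀ q.1) else if q.2 = 1 then B q.1 0 else B q.1 1
  let mark : Fin (I 1).card ⊕ (Fin (I 2).card × Fin 3) → Finset κ :=
    Sum.elim (fun j => F (f₁ j))
      fun q => if q.2 = 2 then ∅ else if q.2 = 1 then {u q.1 0} else {u q.1 1}
  have hbase : ∀ i, base i ⊆ U (idx i) := by
    rintro (j | ⟨j, c⟩)
    · exact subset_rfl
    · simp only [base, idx, Sum.elim_inr]
      split_ifs
      · exact subset_rfl
      · exact hBU j 0
      · exact hBU j 1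
  have hmb : ∀ i, mark i ⊆ base i := by
    rintro (j | ⟨j, c⟩)
    · exact (h.piece _).subset
    · simp only [base, mark, Sum.elim_inr]
      split_ifs
      · exact Finset.empty_subset _
      · simpa using (huB j 0).1
      · simpa using (huB j 1).1
  have hmF : ∀ i, mark i ⊆ Finset.univ.biUnion F := by
    rintro (j | ⟨j, c⟩)
    · exact Finset.subset_biUnion_of_mem F (Finset.mem_univ _)
    · simp only [mark, Sum.elim_inr]
      split_ifs
      · exact Finset.empty_subset _
      · exact Finset.singleton_subset_iff.2 (Finset.mem_biUnion.2 ⟨_, Finset.mem_univ _, (huB j 0).2⟩)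
      · exact Finset.singleton_subset_iff.2 (Finset.mem_biUnion.2 ⟨_, Finset.mem_univ _, (huB j 1).2⟩)
  have hbc : ∀ i, Clustered K (base i) := by
    rintro (j | ⟨j, c⟩)
    · obtain ⟨x, -, y, -, l, hl, hU⟩ := hpath (f₁ j) (by rw [hf₁]; omega)
      simpa [base, hU] using hl.clustered
    · simp only [base, Sum.elim_inr]
      split_ifs
      · obtain ⟨x, -, y, -, l, hl, hU⟩ := hpath (f₀ j) (by rw [hf₀]; omega)
        rw [hU]
        exact hl.clustered
      · exact hBc j 0
      · exact hBc j 1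
  have hbd : Pairwise fun i j => Disjoint (base i) (base j) := by
    intro i i' hne
    by_cases hidx : idx i = idx i'
    · rcases i with j | ⟨j, c⟩ <;> rcases i' with j' | ⟨j', c'⟩
      · exact absurd (congrArg Sum.inl (f₁.injective (Subtype.ext hidx))) hne
      · exfalso
        have e₁ := hf₁ j
        have e₂ := hf₀ j'
        have e₃ := hf₂ j'
        simp only [idx, Sum.elim_inl, Sum.elim_inr] at hidx
        rw [hidx] at e₁
        split_ifs at e₁ <;> omega
      · exfalso
        have e₁ := hf₁ j'
        have e₂ := hf₀ j
        have e₃ := hf₂ j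
        simp only [idx, Sum.elim_inl, Sum.elim_inr] at hidx
        rw [← hidx] at e₁
        split_ifs at e₁ <;> omega
      · have e₁ := hf₀ j
        have e₂ := hf₂ j
        have e₁' := hf₀ j'
        have e₂' := hf₂ j'
        simp only [idx, base, Sum.elim_inr] at hidx ⊢
        by_cases hc : c = 2 <;> by_cases hc' : c' = 2
        · simp only [hc, hc', if_true] at hidx
          have := f₀.injective (Subtype.ext hidx)
          subst this
          exact absurd (by rw [hc, hc']) hne
        · simp only [hc, hc', if_true, if_false] at hidx
          rw [hidx] at e₁
          omega
        · simp only [hc, hc', if_true, if_false] at hidx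
          rw [hidx] at e₂
          omega
        · simp only [hc, hc', if_false] at hidx ⊢
          have := f₂.injective (Subtype.ext hidx)
          subst this
          have hcc : c ≠ c' := fun h => hne (by rw [h])
          split_ifs with g g'
          · exact absurd (g.trans g'.symm) hcc
          · exact hBd j
          · exact (hBd j).symm
          · exfalso
            omega
    · exact (h.disj _ _ hidx).mono (hbase i) (hbase i')
  have hbU : ∀ i, base i ⊆ Finset.univ.biUnion U := fun i =>
    (hbase i).trans (Finset.subset_biUnion_of_mem U (Finset.mem_univ _))
  have hend : ∀ e ∈ Finset.univ.biUnion F, e ∈ (p e).toFinset := fun e he => by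
    obtain ⟨_, _, hl⟩ := h.linkage.link e he
    simpa using hl.end_mem
  have hZ : ∀ i, (mark i).Nonempty → ∃ v ∈ T 2,
      v ∈ base i ∪ (mark i).biUnion fun e => (p e).toFinset := by
    rintro i ⟨e, he⟩
    obtain ⟨a, ha, hl⟩ := h.linkage.link e (hmF i he)
    exact ⟨a, ha, Finset.mem_union_right _ (Finset.mem_biUnion.2 ⟨e, he, by
      simpa using hl.start_mem⟩)⟩
  have hXY : ∀ i d, (∃ v ∈ T d, v ∈ base i) → ∃ v ∈ T d,
      v ∈ base i ∪ (mark i).biUnion fun e => (p e).toFinset := by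
    rintro i d ⟨v, hv, hvb⟩
    exact ⟨v, hv, Finset.mem_union_left _ hvb⟩
  refine ⟨(I 1).card, (I 2).card, by omega,
    fun i => base i ∪ (mark i).biUnion fun e => (p e).toFinset, ?_, ?_, ?_, ?_⟩
  · intro i i' hne
    have hd := Finset.disjoint_left.1 (hbd hne)
    rw [Finset.disjoint_left]
    intro a ha ha'
    simp only [Finset.mem_union, Finset.mem_biUnion, List.mem_toFinset] at ha ha'
    rcases ha with ha | ⟨e, he, ha⟩ <;> rcases ha' with ha' | ⟨e', he', ha'⟩
    · exact hd ha ha'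
    · have := h.linkage.only e' (hmF i' he') a ha' (hbU i ha)
      exact hd ha (this ▸ hmb i' he')
    · have := h.linkage.only e (hmF i he) a ha (hbU i' ha')
      exact hd (this ▸ hmb i he) ha'
    · have hee : e ≠ e' := fun hee => hd (hmb i he) (hee ▸ hmb i' he')
      exact h.linkage.disj e (hmF i he) e' (hmF i' he') hee ha ha'
  · intro i
    refine (hbc i).union_biUnion (hmb i) (fun e he => ?_) fun e he => hend e (hmF i he)
    obtain ⟨_, _, hl⟩ := h.linkage.link e (hmF i he)
    exact hl.clustered
  · intro j d
    obtain ⟨x, hx, y, hy, l, hl, hU⟩ := hpath (f₁ j) (by rw [hf₁]; omega)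
    fin_cases d
    · exact hXY _ 0 ⟨x, hx, by simpa [base, hU] using hl.start_mem⟩
    · exact hXY _ 1 ⟨y, hy, by simpa [base, hU] using hl.end_mem⟩
    · exact hZ _ (Finset.card_pos.1 (by simp [mark, hf₁]))
  · intro j c d hdc
    obtain ⟨x, hx, y, hy, l, hl, hU⟩ := hpath (f₀ j) (by rw [hf₀]; omega)
    fin_cases c <;> fin_cases d
    · exact absurd rfl hdc
    · exact hXY _ 1 (by simpa [base] using hB1 j)
    · exact hZ _ (by simp [mark])
    · exact hXY _ 0 (by simpa [base] using hB0 j)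
    · exact absurd rfl hdc
    · exact hZ _ (by simp [mark])
    · exact hXY _ 0 ⟨x, hx, by simpa [base, hU] using hl.start_mem⟩
    · exact hXY _ 1 ⟨y, hy, by simpa [base, hU] using hl.end_mem⟩
    · exact absurd rfl hdc

end

/-! ### Internally disjoint trees from disjoint vertex sets -/

theorem exists_isTree_subgraph {V : Type*} [Finite V] {G : SimpleGraph V} (C : G.Subgraph)
    (hC : C.coe.Connected) : ∃ T ≤ C, T.verts = C.verts ∧ T.coe.IsTree := by
  obtain ⟨T, hle, hT⟩ := hC.exists_isTree_le
  let T' : G.Subgraph :=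
    { verts := C.verts
      Adj := fun u v => ∃ hu hv, T.Adj ⟨u, hu⟩ ⟨v, hv⟩
      adj_sub := fun ⟨_, _, h⟩ => C.adj_sub (hle h)
      edge_vert := fun ⟨hu, _, _⟩ => hu
      symm := ⟨fun _ _ ⟨hu, hv, h⟩ => ⟨hv, hu, h.symm⟩⟩ }
  have : T'.coe = T := by
    ext ⟨a, ha⟩ ⟨b, hb⟩
    exact ⟨fun ⟨_, _, h⟩ => h, fun h => ⟨ha, hb, h⟩⟩
  exact ⟨T', ⟨subset_rfl, fun _ _ ⟨_, _, h⟩ => hle h⟩, rfl, this ▸ hT⟩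

/-- Adjacency in the subgraph with vertex set `S ∪ A` from which the edges within `S` that are not
in `D` have been removed. -/
def StepIn {V : Type*} (G : SimpleGraph V) (S : Finset V) (A : Set V) (D : Set (Sym2 V))
    (u v : V) : Prop :=
  G.Adj u v ∧ (u ∈ S ∨ u ∈ A) ∧ (v ∈ S ∨ v ∈ A) ∧ (u ∈ S → v ∈ S → s(u, v) ∈ D)

theorem StepIn.symm {V : Type*} {G : SimpleGraph V} {S : Finset V} {A : Set V} {D : Set (Sym2 V)}
    {u v : V} (h : StepIn G S A D u v) : StepIn G S A D v u :=
  ⟨h.1.symm, h.2.2.1, h.2.1, fun hv hu => Sym2.eq_swap ▸ h.2.2.2 hu hv⟩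

theorem reflTransGen_stepIn_symm {V : Type*} {G : SimpleGraph V} {S : Finset V} {A : Set V}
    {D : Set (Sym2 V)} {u v : V} (h : Relation.ReflTransGen (StepIn G S A D) u v) :
    Relation.ReflTransGen (StepIn G S A D) v u :=
  Relation.ReflTransGen.mono (fun _ _ h => StepIn.symm h) _ _ h.swap

theorem IsSteinerTree.exists_adj {V : Type*} {G : SimpleGraph V} {S : Finset V} {T : G.Subgraph}
    (h : IsSteinerTree S T) {u v : V} (hu : u ∈ S) (hv : v ∈ S) (huv : u ≠ v) :
    ∃ w, T.Adj u w := by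
  obtain ⟨p⟩ := h.1.connected.preconnected ⟨u, h.2 hu⟩ ⟨v, h.2 hv⟩
  cases p with
  | nil => exact absurd rfl huv
  | cons hadj _ => exact ⟨_, hadj⟩

/-- Each `A i`, together with `S`, spans a connected subgraph, of which a spanning tree is taken.
Common vertices lie in `S`, so only edges within `S` could be shared; the sets `D i` ration these.
-/
theorem card_le_localConnectivity {V ι : Type*} [Finite V] [Fintype ι] {G : SimpleGraph V}
    {S : Finset V} (hS : 1 < S.card) (A : ι → Set V) (D : ι → Set (Sym2 V))
    (hA : Pairwise fun i j => Disjoint (A i) (A j)) (hD : Pairwise fun i j => Disjoint (D i) (D j))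
    (hconn : ∀ i, ∃ c, ∀ v, (v ∈ S ∨ v ∈ A i) →
      Relation.ReflTransGen (StepIn G S (A i) (D i)) v c) :
    Fintype.card ι ≤ localConnectivity G S := by
  classical
  let C : ι → G.Subgraph := fun i =>
    { verts := {v | v ∈ S ∨ v ∈ A i}
      Adj := StepIn G S (A i) (D i)
      adj_sub := fun h => h.1
      edge_vert := fun h => h.2.1
      symm := ⟨fun _ _ h => h.symm⟩ }
  obtain ⟨a, ha, b, hb, hab⟩ := Finset.one_lt_card.1 hS
  have hC : ∀ i, (C i).coe.Connected := by
    intro i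
    obtain ⟨c, hc⟩ := hconn i
    have hreach : ∀ u v, Relation.ReflTransGen (StepIn G S (A i) (D i)) u v →
        ∀ (hu : u ∈ (C i).verts) (hv : v ∈ (C i).verts),
          (C i).coe.Reachable ⟨u, hu⟩ ⟨v, hv⟩ := by
      intro u v h
      induction h with
      | refl => exact fun _ _ => .refl _
      | @tail v w _ hvw ih =>
        intro hu hw
        refine (ih hu hvw.2.1).trans (SimpleGraph.Adj.reachable ?_)
        exact hvw
    have : Nonempty (C i).verts := ⟨⟨a, .inl ha⟩⟩
    refine ⟨fun u v => hreach u v ?_ u.2 v.2⟩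
    exact (hc u u.2).trans (reflTransGen_stepIn_symm (hc v v.2))
  choose T hTC hTv hT using fun i => exists_isTree_subgraph (C i) (hC i)
  have hst : ∀ i, IsSteinerTree S (T i) := fun i => ⟨hT i, fun v hv => by
    rw [hTv]; exact .inl hv⟩
  have hdis : ∀ i j, i ≠ j → InternallyDisjoint S (T i) (T j) := by
    intro i j hij
    have hv : ∀ v, (v ∈ S ∨ v ∈ A i) → (v ∈ S ∨ v ∈ A j) → v ∈ S := by
      rintro v (h | h) (h' | h')
      · exact h
      · exact h
      · exact h'
      · exact (Set.disjoint_left.1 (hA hij) h h').elim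
    constructor
    · rw [Set.eq_empty_iff_forall_notMem]
      intro e
      induction e using Sym2.ind with
      | _ u v =>
      rintro ⟨h, h'⟩
      rw [SimpleGraph.Subgraph.mem_edgeSet] at h h'
      have g : StepIn G S (A i) (D i) u v := (hTC i).2 h
      have g' : StepIn G S (A j) (D j) u v := (hTC j).2 h'
      have hu := hv u g.2.1 g'.2.1
      have hv := hv v g.2.2.1 g'.2.2.1
      exact Set.disjoint_left.1 (hD hij) (g.2.2.2 hu hv) (g'.2.2.2 hu hv)
    · rw [hTv, hTv]
      ext v
      exact ⟨fun h => hv v h.1 h.2, fun h => ⟨.inl h, .inl h⟩⟩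
  -- Equal trees would share all edges, yet a tree containing two vertices of `S` has an edge.
  have hinj : Function.Injective T := by
    intro i j hij
    by_contra hne
    have h := (hdis i j hne).1
    rw [hij, Set.inter_self] at h
    obtain ⟨w, hw⟩ := (hst j).exists_adj ha hb hab
    have : s(a, w) ∈ (T j).edgeSet := hw
    rw [h] at this
    exact this
  refine le_csSup (bddAbove_localConnectivity G S) ⟨Finset.univ.image T, ?_, ?_, ?_⟩
  · rw [Finset.card_image_of_injective _ hinj, Finset.card_univ]
  · intro t ht
    obtain ⟨i, -, rfl⟩ := Finset.mem_image.1 ht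
    exact hst i
  · intro t ht t' ht' hne
    obtain ⟨i, -, rfl⟩ := Finset.mem_image.1 ht
    obtain ⟨j, -, rfl⟩ := Finset.mem_image.1 ht'
    exact hdis i j fun h => hne (h ▸ rfl)

/-! ### Three vertices of a highly connected graph -/

/-- `G` has more than one vertex and is connected after the deletion of fewer than `m` vertices. -/
def IsHighlyConnected {V : Type*} (G : SimpleGraph V) (m : ℕ) : Prop :=
  ∀ X : Finset V, X.card < m →
    (G.induce {v | v ∉ X}).Preconnected ∧ ¬ {v | v ∉ X}.Subsingleton

theorem isHighlyConnected_connectivity {V : Type*} (G : SimpleGraph V) :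
    IsHighlyConnected G (connectivity G) := by
  intro X hX
  have := Nat.notMem_of_lt_sInf hX
  by_contra h
  exact this ⟨X, rfl, by tauto⟩

theorem IsHighlyConnected.mem_of_closed {V : Type*} {G : SimpleGraph V} {m : ℕ}
    (h : IsHighlyConnected G m) {X : Finset V} (hX : X.card < m) {R : Set V}
    (hR : ∀ u v, u ∈ R → u ∉ X → v ∉ X → G.Adj u v → v ∈ R) {u v : V} (hu : u ∈ R) (huX : u ∉ X)
    (hvX : v ∉ X) : v ∈ R := by
  obtain ⟨p⟩ := (h X hX).1 ⟨u, huX⟩ ⟨v, hvX⟩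
  have key : ∀ (a b : {v | v ∉ X}), (G.induce {v | v ∉ X}).Walk a b → (a : V) ∈ R → (b : V) ∈ R := by
    intro a b p
    induction p with
    | nil => exact id
    | @cons u v w hadj _ ih => exact fun ha => ih (hR u v ha u.2 v.2 hadj)
  exact key _ _ p hu

/-- A mixed cut of vertices `C₀` and terminal edges `C₁`, each edge indexed by the opposite
terminal, becomes a vertex cut of no larger size by deleting an end of each cut edge. The ends must
be chosen so that something remains to be separated. -/
theorem IsHighlyConnected.no_mixed_cut_one {V : Type*} {G : SimpleGraph V} {m : ℕ}
    (h : IsHighlyConnected G m) {s : Fin 3 → V} (hs : Function.Injective s) {C₀ : Finset V}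
    (hC₀ : ∀ l, s l ∉ C₀) {C₁ : Finset (Fin 3)} (hcard : C₀.card + C₁.card < m) {R : Set V}
    {p q r : Fin 3} (hpq : p ≠ q) (hpr : p ≠ r) (hqr : q ≠ r)
    (hp : s p ∈ R) (hq : s q ∉ R) (hr : s r ∉ R)
    (hR : ∀ u v, u ∈ R → u ∉ C₀ → v ∉ R → v ∉ C₀ → G.Adj u v →
      (u = s p ∧ v = s q ∧ r ∈ C₁) ∨ (u = s p ∧ v = s r ∧ q ∈ C₁)) : False := by
  classical
  have sne : ∀ {l l'}, l ≠ l' → s l ≠ s l' := fun hl h => hl (hs h)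
  by_cases hrC : r ∈ C₁ <;> by_cases hqC : q ∈ C₁
  -- With both edges at `s p` cut, deleting `s q` and `s r` leaves only the side `R`, while deleting
  -- `s p` alone shows that this side is just `s p`. Then fewer than `m` deletions leave at most one
  -- vertex.
  · have h2 : 2 ≤ C₁.card := by
      rw [← Finset.card_pair hqr]
      exact Finset.card_le_card (by simp [Finset.insert_subset_iff, hrC, hqC])
    have c1 : (insert (s q) (insert (s r) C₀)).card < m := by
      have := Finset.card_insert_le (s q) (insert (s r) C₀)
      have := Finset.card_insert_le (s r) C₀
      omega
    have c2 : (insert (s p) C₀).card < m := by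
      have := Finset.card_insert_le (s p) C₀
      omega
    have a1 : ∀ v, v ∉ insert (s q) (insert (s r) C₀) → v ∈ R := by
      intro v hv
      refine h.mem_of_closed c1 (R := R) (fun u w hu huX hwX huw => ?_) hp
        (by simp [sne hpq, sne hpr, hC₀]) hv
      by_contra hw
      simp only [Finset.mem_insert, not_or] at huX hwX
      rcases hR u w hu huX.2.2 hw hwX.2.2 huw with ⟨-, h, -⟩ | ⟨-, h, -⟩
      · exact hwX.1 h
      · exact hwX.2.1 h
    have a2 : ∀ v ∈ R, v ∉ C₀ → v = s p := by
      intro v hv hv₀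
      by_contra hvp
      refine hq (h.mem_of_closed c2 (R := R) (fun u w hu huX hwX huw => ?_) hv
        (by simp [hvp, hv₀]) (by simp [sne hpq.symm, hC₀]))
      by_contra hw
      simp only [Finset.mem_insert, not_or] at huX hwX
      rcases hR u w hu huX.2 hw hwX.2 huw with ⟨h, -⟩ | ⟨h, -⟩ <;> exact huX.1 h
    refine (h _ c1).2 fun v hv w hw => ?_
    have hv' : v ∉ C₀ := fun h => hv (by simp [h])
    have hw' : w ∉ C₀ := fun h => hw (by simp [h])
    rw [a2 v (a1 v hv) hv', a2 w (a1 w hw) hw']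
  · have h1 : 1 ≤ C₁.card := Finset.card_pos.2 ⟨r, hrC⟩
    have c : (insert (s q) C₀).card < m := by
      have := Finset.card_insert_le (s q) C₀
      omega
    refine hr (h.mem_of_closed c (R := R) (fun u w hu huX hwX huw => ?_) hp
      (by simp [sne hpq, hC₀]) (by simp [sne hqr.symm, hC₀]))
    by_contra hw
    simp only [Finset.mem_insert, not_or] at huX hwX
    rcases hR u w hu huX.2 hw hwX.2 huw with ⟨-, h, -⟩ | ⟨-, -, h⟩
    · exact hwX.1 h
    · exact hqC h
  · have h1 : 1 ≤ C₁.card := Finset.card_pos.2 ⟨q, hqC⟩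
    have c : (insert (s r) C₀).card < m := by
      have := Finset.card_insert_le (s r) C₀
      omega
    refine hq (h.mem_of_closed c (R := R) (fun u w hu huX hwX huw => ?_) hp
      (by simp [sne hpr, hC₀]) (by simp [sne hqr, hC₀]))
    by_contra hw
    simp only [Finset.mem_insert, not_or] at huX hwX
    rcases hR u w hu huX.2 hw hwX.2 huw with ⟨-, -, h⟩ | ⟨-, h, -⟩
    · exact hrC h
    · exact hwX.1 h
  · refine hq (h.mem_of_closed (X := C₀) (by omega) (R := R) (fun u w hu huX hwX huw => ?_) hp
      (hC₀ _) (hC₀ _))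
    by_contra hw
    rcases hR u w hu huX hw hwX huw with ⟨-, -, h⟩ | ⟨-, -, h⟩
    · exact hrC h
    · exact hqC h

/-- One of the two sides contains exactly one terminal; that side, `R` or its complement, is the one
to use. -/
theorem IsHighlyConnected.no_mixed_cut {V : Type*} {G : SimpleGraph V} {m : ℕ}
    (h : IsHighlyConnected G m) {s : Fin 3 → V} (hs : Function.Injective s) {C₀ : Finset V}
    (hC₀ : ∀ l, s l ∉ C₀) {C₁ : Finset (Fin 3)} (hcard : C₀.card + C₁.card < m) {R : Set V}
    {i j : Fin 3} (hi : s i ∈ R) (hj : s j ∉ R)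
    (hR : ∀ u v, u ∈ R → u ∉ C₀ → v ∉ R → v ∉ C₀ → G.Adj u v →
      ∃ l l' k, l ≠ l' ∧ l ≠ k ∧ l' ≠ k ∧ u = s l ∧ v = s l' ∧ k ∈ C₁) : False := by
  have hij : i ≠ j := fun h => hj (h ▸ hi)
  obtain ⟨t, hit, hjt⟩ : ∃ t : Fin 3, i ≠ t ∧ j ≠ t := by
    clear hR hj hi hcard
    revert i j; decide
  by_cases ht : s t ∈ R
  · refine h.no_mixed_cut_one hs hC₀ hcard (R := Rᶜ) hij.symm hjt hit hj (by simpa using hi)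
      (by simpa using ht) fun u v hu huC hv hvC huv => ?_
    obtain ⟨l, l', k, hll, hlk, hlk', rfl, rfl, hk⟩ := hR v u (by simpa using hv) hvC hu huC huv.symm
    have hl' : l' = j := by
      by_contra hne
      have : l' = i ∨ l' = t := by omega
      rcases this with rfl | rfl
      · exact hu hi
      · exact hu ht
    subst hl'
    have : (l = i ∧ k = t) ∨ (l = t ∧ k = i) := by omega
    rcases this with ⟨rfl, rfl⟩ | ⟨rfl, rfl⟩
    · exact .inl ⟨rfl, rfl, hk⟩
    · exact .inr ⟨rfl, rfl, hk⟩
  · refine h.no_mixed_cut_one hs hC₀ hcard (R := R) hij hit hjt hi hj ht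
      fun u v hu huC hv hvC huv => ?_
    obtain ⟨l, l', k, hll, hlk, hlk', rfl, rfl, hk⟩ := hR u v hu huC hv hvC huv
    have hl : l = i := by
      by_contra hne
      have : l = j ∨ l = t := by omega
      rcases this with rfl | rfl
      · exact hj hu
      · exact ht hu
    subst hl
    have : (l' = j ∧ k = t) ∨ (l' = t ∧ k = j) := by omega
    rcases this with ⟨rfl, rfl⟩ | ⟨rfl, rfl⟩
    · exact .inl ⟨rfl, rfl, hk⟩
    · exact .inr ⟨rfl, rfl, hk⟩

/-! ### Cloned terminals and contraction back to `G`. -/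

/-- The vertices of the graph obtained from a graph on `V` by subdividing the edges between three
terminals and replacing each terminal by `m` clones: `inl v` is the vertex `v`, `inr (inl k)`
subdivides the edge between the terminals other than `k`, and `inr (inr (i, a))` is the `a`-th clone
of the terminal `i`. -/
abbrev Node (V : Type*) (m : ℕ) := V ⊕ (Fin 3 ⊕ (Fin 3 × Fin m))

/-- One direction of the adjacency relation of `cloneGraph`. -/
def cloneRel {V : Type*} (G : SimpleGraph V) (s : Fin 3 → V) (m : ℕ) : Node V m → Node V m → Prop
  | .inl u, .inl v => G.Adj u v ∧ (∀ l, u ≠ s l) ∧ ∀ l, v ≠ s l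
  | .inl u, .inr (.inr (i, _)) => G.Adj u (s i) ∧ ∀ l, u ≠ s l
  | .inr (.inl k), .inr (.inr (i, _)) => i ≠ k ∧ G.Adj (s (k + 1)) (s (k + 2))
  | _, _ => False

/-- The graph obtained from `G` by subdividing the edges between the terminals `s i` and replacing
each terminal by `m` clones. The terminals themselves remain as isolated vertices. -/
def cloneGraph {V : Type*} (G : SimpleGraph V) (s : Fin 3 → V) (m : ℕ) : SimpleGraph (Node V m) :=
  SimpleGraph.fromRel (cloneRel G s m)

/-- The set of clones of the terminal `i`. -/
def clones (V : Type*) (m : ℕ) (i : Fin 3) : Finset (Node V m) :=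
  Finset.univ.map ⟨fun a : Fin m => .inr (.inr (i, a)), fun a b h => by simpa using h⟩

theorem mem_clones {V : Type*} {m : ℕ} {i : Fin 3} {x : Node V m} :
    x ∈ clones V m i ↔ ∃ a, x = .inr (.inr (i, a)) := by
  simp only [clones, Finset.mem_map, Finset.mem_univ, true_and]
  exact ⟨fun ⟨a, h⟩ => ⟨a, h.symm⟩, fun ⟨a, h⟩ => ⟨a, h.symm⟩⟩

theorem card_clones (V : Type*) (m : ℕ) (i : Fin 3) : (clones V m i).card = m := by
  simp [clones]

/-- Fewer than `m` nodes leave a clone of every terminal, so deleted clones are harmless. The other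
deleted nodes amount to a mixed cut of vertices and terminal edges of `G`. -/
theorem IsHighlyConnected.unseparated_clones {V : Type*} [Fintype V] {G : SimpleGraph V} {m : ℕ}
    (h : IsHighlyConnected G m) {s : Fin 3 → V} (hs : Function.Injective s) (i j : Fin 3) :
    Unseparated (cloneGraph G s m) m (clones V m i) (clones V m j) := by
  classical
  intro C hC
  have hclone : ∀ l : Fin 3, ∃ a : Fin m, (.inr (.inr (l, a)) : Node V m) ∉ C := by
    intro l
    by_contra hall
    push Not at hall
    have : clones V m l ⊆ C := fun x hx => by
      obtain ⟨a, rfl⟩ := mem_clones.1 hx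
      exact hall a
    have := Finset.card_le_card this
    rw [card_clones] at this
    omega
  obtain ⟨a₀, ha₀⟩ := hclone i
  set Q : Node V m → Prop := Relation.ReflTransGen
    (fun u v => (cloneGraph G s m).Adj u v ∧ v ∉ C) (.inr (.inr (i, a₀))) with hQ
  by_cases hex : ∃ b, Q (.inr (.inr (j, b)))
  · obtain ⟨b, hb⟩ := hex
    obtain ⟨l, hl⟩ := exists_isLink_of_reflTransGen (P := (· ∉ C)) ha₀ hb
    exact ⟨_, mem_clones.2 ⟨a₀, rfl⟩, _, mem_clones.2 ⟨b, rfl⟩, l, hl⟩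
  exfalso
  have hstep : ∀ x y, Q x → (cloneRel G s m x y ∨ cloneRel G s m y x) → x ≠ y → y ∉ C → Q y :=
    fun x y hx hxy hne hy => hx.tail ⟨(SimpleGraph.fromRel_adj _ _ _).2 ⟨hne, hxy⟩, hy⟩
  set R : Set V := {v | ((∀ l, v ≠ s l) ∧ Q (.inl v)) ∨ ∃ l, v = s l ∧ ∃ a, Q (.inr (.inr (l, a)))}
    with hRdef
  have hsR : ∀ l, s l ∈ R ↔ ∃ a, Q (.inr (.inr (l, a))) := by
    intro l
    constructor
    · rintro (⟨h, -⟩ | ⟨l', h, h'⟩)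
      · exact absurd rfl (h l)
      · obtain rfl := hs h
        exact h'
    · exact fun h => .inr ⟨l, rfl, h⟩
  set C₀ : Finset V := Finset.univ.filter fun v => (∀ l, v ≠ s l) ∧ (.inl v : Node V m) ∈ C
    with hC₀def
  set C₁ : Finset (Fin 3) := Finset.univ.filter fun k => (.inr (.inl k) : Node V m) ∈ C with hC₁def
  have hcard : C₀.card + C₁.card < m := by
    refine lt_of_le_of_lt ?_ hC
    rw [← Finset.card_disjSum]
    let f : V ⊕ Fin 3 ↪ Node V m := ⟨Sum.map id Sum.inl, Function.Injective.sumMap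
      Function.injective_id Sum.inl_injective⟩
    rw [← Finset.card_map f]
    refine Finset.card_le_card fun x hx => ?_
    obtain ⟨y, hy, rfl⟩ := Finset.mem_map.1 hx
    rcases y with v | k
    · have := Finset.inl_mem_disjSum.1 hy
      exact (Finset.mem_filter.1 this).2.2
    · have := Finset.inr_mem_disjSum.1 hy
      exact (Finset.mem_filter.1 this).2
  have hC₀ : ∀ l, s l ∉ C₀ := fun l hl => (Finset.mem_filter.1 hl).2.1 l rfl
  refine h.no_mixed_cut hs hC₀ hcard (R := R) (i := i) (j := j) ((hsR i).2 ⟨a₀, .refl⟩)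
    (fun hj => hex ((hsR j).1 hj)) fun u v hu _ hv hvC huv => ?_
  have hin : (∀ l, v ≠ s l) → ¬ Q (.inl v) ∧ (.inl v : Node V m) ∉ C := fun hvs =>
    ⟨fun hq => hv (.inl ⟨hvs, hq⟩), fun hc => hvC (by simp [hC₀def, hvs, hc])⟩
  by_cases hvs : ∀ l, v ≠ s l
  · obtain ⟨hvQ, hvC⟩ := hin hvs
    exfalso
    rcases hu with ⟨hus, hu⟩ | ⟨l, rfl, a, hu⟩
    · exact hvQ (hstep _ _ hu (.inl ⟨huv, hus, hvs⟩) (by simpa using huv.ne) hvC)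
    · exact hvQ (hstep _ _ hu (.inr ⟨huv.symm, hvs⟩) (by simp) hvC)
  · push Not at hvs
    obtain ⟨l', rfl⟩ := hvs
    obtain ⟨b, hb⟩ := hclone l'
    have hvQ : ¬ Q (.inr (.inr (l', b))) := fun h => hv ((hsR l').2 ⟨b, h⟩)
    rcases hu with ⟨hus, hu⟩ | ⟨l, rfl, a, hu⟩
    · exact (hvQ (hstep _ _ hu (.inl ⟨huv, hus⟩) (by simp) hb)).elim
    · have hll : l ≠ l' := fun h => huv.ne (h ▸ rfl)
      obtain ⟨k, hlk, hlk'⟩ : ∃ k : Fin 3, l ≠ k ∧ l' ≠ k := by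
        clear * - hll
        revert l l'; decide
      refine ⟨l, l', k, hll, hlk, hlk', rfl, rfl, ?_⟩
      by_contra hk
      have hkC : (.inr (.inl k) : Node V m) ∉ C := fun hc => hk (by simp [hC₁def, hc])
      have hadj : G.Adj (s (k + 1)) (s (k + 2)) := by
        have : (l = k + 1 ∧ l' = k + 2) ∨ (l' = k + 1 ∧ l = k + 2) := by
          clear * - hll hlk hlk'
          revert l l' k; decide
        rcases this with ⟨rfl, rfl⟩ | ⟨rfl, rfl⟩
        · exact huv
        · exact huv.symm
      exact hvQ (hstep _ _ (hstep _ (.inr (.inl k)) hu (.inr ⟨hlk, hadj⟩) (by simp) hkC)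
        (.inl ⟨hlk', hadj⟩) (by simp) hb)

/-- The vertex of `G` onto which a vertex of `cloneGraph G s m` is contracted. -/
def contract {V : Type*} (s : Fin 3 → V) (m : ℕ) : Node V m → V
  | .inl v => v
  | .inr (.inl k) => s (k + 1)
  | .inr (.inr (i, _)) => s i

section Contract

variable {V : Type*} {G : SimpleGraph V} {s : Fin 3 → V} {m : ℕ} {S : Finset V}

/-- A subdividing vertex collapses onto one end of its edge: one half of the edge becomes trivial
and the other becomes the edge itself, which `T` may use as it owns the subdividing vertex. -/
theorem reflTransGen_contract_of_rel (hS : ∀ v, v ∈ S ↔ ∃ l, v = s l) {T : Set (Node V m)}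
    {x y : Node V m} (hx : x ∈ T) (hy : y ∈ T) (h : cloneRel G s m x y) :
    Relation.ReflTransGen (StepIn G S {v | .inl v ∈ T}
      {e | ∃ k, e = s(s (k + 1), s (k + 2)) ∧ .inr (.inl k) ∈ T})
      (contract s m x) (contract s m y) := by
  rcases x with u | k | ⟨i, a⟩ <;> rcases y with v | k' | ⟨j, b⟩ <;>
    simp only [cloneRel] at h
  · refine .single ⟨h.1, .inr hx, .inr hy, fun hu _ => ?_⟩
    obtain ⟨l, hl⟩ := (hS u).1 hu
    exact absurd hl (h.2.1 l)
  · refine .single ⟨h.1, .inr hx, .inl ((hS _).2 ⟨j, rfl⟩), fun hu _ => ?_⟩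
    obtain ⟨l, hl⟩ := (hS u).1 hu
    exact absurd hl (h.2 l)
  · have : j = k + 1 ∨ j = k + 2 := by
      have := h.1
      clear * - this
      revert j k; decide
    rcases this with rfl | rfl
    · exact .refl
    · exact .single ⟨h.2, .inl ((hS _).2 ⟨_, rfl⟩), .inl ((hS _).2 ⟨_, rfl⟩),
        fun _ _ => ⟨k, rfl, hx⟩⟩

theorem Clustered.contract {W : Finset (Node V m)} (hW : Clustered (cloneGraph G s m) W)
    (hS : ∀ v, v ∈ S ↔ ∃ l, v = s l) {T : Set (Node V m)} (hWT : ∀ x ∈ W, x ∈ T)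
    {x y : Node V m} (hx : x ∈ W) (hy : y ∈ W) :
    Relation.ReflTransGen (StepIn G S {v | .inl v ∈ T}
      {e | ∃ k, e = s(s (k + 1), s (k + 2)) ∧ .inr (.inl k) ∈ T})
      (contract s m x) (contract s m y) := by
  have := hW x hx y hy
  clear hy
  induction this with
  | refl => exact .refl
  | tail _ h ih =>
    refine ih.trans ?_
    rcases ((SimpleGraph.fromRel_adj _ _ _).1 h.1).2 with h' | h'
    · exact reflTransGen_contract_of_rel hS (hWT _ h.2.1) (hWT _ h.2.2) h'
    · exact reflTransGen_stepIn_symm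
        (reflTransGen_contract_of_rel hS (hWT _ h.2.2) (hWT _ h.2.1) h')

end Contract

/-- In a graph of connectivity at least `m`, any three vertices are connected by
`⌊(3 m + 1) / 4⌋` internally disjoint trees. -/
theorem IsHighlyConnected.le_localConnectivity {V : Type*} [Fintype V] {G : SimpleGraph V} {m : ℕ}
    (h : IsHighlyConnected G m) {S : Finset V} (hS : S.card = 3) :
    (3 * m + 1) / 4 ≤ localConnectivity G S := by
  classical
  let s : Fin 3 → V := fun i => (S.equivFinOfCardEq hS).symm i
  have hs : Function.Injective s :=
    Subtype.val_injective.comp (S.equivFinOfCardEq hS).symm.injective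
  have hsS : ∀ v, v ∈ S ↔ ∃ l, v = s l := by
    intro v
    constructor
    · exact fun hv => ⟨S.equivFinOfCardEq hS ⟨v, hv⟩, by simp [s]⟩
    · rintro ⟨l, rfl⟩
      exact ((S.equivFinOfCardEq hS).symm l).2
  obtain ⟨c₁, c₂, hc, W, hd, hcl, h₁, h₂⟩ := exists_clusters (clones V m) (card_clones V m 0)
    (h.unseparated_clones hs 0 1) (h.unseparated_clones hs 2 0)
  -- list the clusters that meet two of the three sets of clones, and pair them consecutively
  have hlt : ∀ (t : Fin (3 * c₂ / 2)) (b : Fin 2), (2 * (t : ℕ) + b) / 3 < c₂ := fun t b => by omega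
  let idx : Fin (3 * c₂ / 2) → Fin 2 → Fin c₂ × Fin 3 := fun t b =>
    (⟨(2 * t + b) / 3, hlt t b⟩, ⟨(2 * t + b) % 3, Nat.mod_lt _ (by omega)⟩)
  have hidx : ∀ t b t' b', idx t b = idx t' b' → t = t' := by
    intro t b t' b' he
    simp only [idx, Prod.mk.injEq, Fin.mk.injEq] at he
    omega
  let L : Fin c₁ ⊕ Fin (3 * c₂ / 2) → Fin 2 → Fin c₁ ⊕ (Fin c₂ × Fin 3) :=
    Sum.elim (fun i _ => .inl i) fun t b => .inr (idx t b)
  have hL : ∀ t b t' b', t ≠ t' → L t b ≠ L t' b' := by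
    rintro (t | t) b (t' | t') b' hne he
    · exact hne (by simpa [L] using he)
    · simp [L] at he
    · simp [L] at he
    · exact hne (by rw [hidx t b t' b' (by simpa [L] using he)])
  let T : Fin c₁ ⊕ Fin (3 * c₂ / 2) → Set (Node V m) := fun t => {x | ∃ b, x ∈ W (L t b)}
  have hT : ∀ t t', t ≠ t' → ∀ x, x ∈ T t → x ∉ T t' := by
    rintro t t' hne x ⟨b, hx⟩ ⟨b', hx'⟩
    exact Finset.disjoint_left.1 (hd (hL t b t' b' hne)) hx hx'
  -- Consecutive positions differ modulo 3, so paired clusters have different exempt terminals. Both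
  -- meet the remaining terminal, and every terminal is met by at least one.
  have hcommon : ∀ t, ∃ d, ∀ b, ∃ v ∈ clones V m d, v ∈ W (L t b) := by
    rintro (t | t)
    · exact ⟨0, fun b => h₁ t 0⟩
    · have hne : (idx t 0).2 ≠ (idx t 1).2 := by
        simp only [idx, ne_eq, Fin.mk.injEq]
        simp
        omega
      obtain ⟨d, hd0, hd1⟩ : ∃ d : Fin 3, d ≠ (idx t 0).2 ∧ d ≠ (idx t 1).2 := by
        generalize (idx t 0).2 = p at hne
        generalize (idx t 1).2 = q at hne
        clear * - hne
        revert p q; decide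
      refine ⟨d, fun b => h₂ _ _ d ?_⟩
      fin_cases b
      · exact hd0
      · exact hd1
  have hall : ∀ t d, ∃ b, ∃ v ∈ clones V m d, v ∈ W (L t b) := by
    rintro (t | t) d
    · exact ⟨0, h₁ t d⟩
    · have hne : (idx t 0).2 ≠ (idx t 1).2 := by
        simp only [idx, ne_eq, Fin.mk.injEq]
        simp
        omega
      by_cases h0 : d = (idx t 0).2
      · exact ⟨1, h₂ _ _ d (h0 ▸ hne)⟩
      · exact ⟨0, h₂ _ _ d h0⟩
  have key := card_le_localConnectivity (ι := Fin c₁ ⊕ Fin (3 * c₂ / 2)) (G := G) (S := S)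
    (by omega) (fun t => {v | .inl v ∈ T t})
    (fun t => {e | ∃ k, e = s(s (k + 1), s (k + 2)) ∧ .inr (.inl k) ∈ T t})
    (fun t t' hne => Set.disjoint_left.2 fun v hv hv' => hT t t' hne _ hv hv')
    (fun t t' hne => Set.disjoint_left.2 ?_) ?_
  -- With c₁ = m − 2c₂ the count is m − ⌈c₂/2⌉, smallest at c₂ = ⌊m/2⌋.
  · refine le_trans ?_ key
    simp only [Fintype.card_sum, Fintype.card_fin]
    omega
  · rintro e ⟨k, rfl, hk⟩ ⟨k', he, hk'⟩
    have : k = k' := by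
      simp only [Sym2.eq_iff, hs.eq_iff] at he
      clear * - he
      revert k k'; decide
    exact hT t t' hne _ hk (this ▸ hk')
  · intro t
    obtain ⟨d, hd⟩ := hcommon t
    refine ⟨s d, ?_⟩
    have hreach : ∀ x ∈ T t, Relation.ReflTransGen (StepIn G S {v | .inl v ∈ T t}
        {e | ∃ k, e = s(s (k + 1), s (k + 2)) ∧ .inr (.inl k) ∈ T t})
        (contract s m x) (s d) := by
      rintro x ⟨b, hx⟩
      obtain ⟨y, hy, hyW⟩ := hd b
      obtain ⟨a, rfl⟩ := mem_clones.1 hy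
      exact (hcl (L t b)).contract hsS (T := T t) (fun x hx => ⟨b, hx⟩) hx hyW
    rintro v (hv | hv)
    · obtain ⟨l, rfl⟩ := (hsS v).1 hv
      obtain ⟨b, y, hy, hyW⟩ := hall t l
      obtain ⟨a, rfl⟩ := mem_clones.1 hy
      exact hreach _ ⟨b, hyW⟩
    · exact hreach _ hv

/-! ### The upper bound from a vertex cut -/

theorem exists_closed_of_not_preconnected {V : Type*} {L : SimpleGraph V} {X : Finset V}
    (h : ¬ (L.induce {v | v ∉ X}).Preconnected) : ∃ u v, u ∉ X ∧ v ∉ X ∧ ∃ R : Set V, u ∈ R ∧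
      v ∉ R ∧ ∀ a b, a ∈ R → b ∉ X → L.Adj a b → b ∈ R := by
  unfold SimpleGraph.Preconnected at h
  push Not at h
  obtain ⟨u, v, huv⟩ := h
  refine ⟨u, v, u.2, v.2, {a | ∃ ha : a ∉ X, (L.induce {v | v ∉ X}).Reachable u ⟨a, ha⟩},
    ⟨u.2, .refl _⟩, fun ⟨_, hv⟩ => huv hv, ?_⟩
  rintro a b ⟨ha, hua⟩ hb hab
  exact ⟨hb, hua.trans (SimpleGraph.Adj.reachable (by simpa using hab))⟩

theorem not_preconnected_of_closed {V : Type*} {L : SimpleGraph V} {X : Finset V} {u v : V}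
    (hu : u ∉ X) (hv : v ∉ X) {R : Set V} (huR : u ∈ R) (hvR : v ∉ R)
    (hR : ∀ a b, a ∈ R → b ∉ X → L.Adj a b → b ∈ R) :
    ¬ (L.induce {v | v ∉ X}).Preconnected := by
  intro h
  obtain ⟨p⟩ := h ⟨u, hu⟩ ⟨v, hv⟩
  have key : ∀ (a b : {v | v ∉ X}), (L.induce {v | v ∉ X}).Walk a b → (a : V) ∈ R → (b : V) ∈ R := by
    intro a b p
    induction p with
    | nil => exact id
    | @cons a b c hadj _ ih => exact fun ha => ih (hR a b ha b.2 hadj)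
  exact hvR (key _ _ p huR)

theorem IsSteinerTree.exists_mem_cut {V : Type*} {L : SimpleGraph V} {S X : Finset V}
    {T : L.Subgraph} (hT : IsSteinerTree S T) {u v : V} (hu : u ∈ S) (hv : v ∈ S) {R : Set V}
    (huR : u ∈ R) (hvR : v ∉ R) (hR : ∀ a b, a ∈ R → b ∉ X → L.Adj a b → b ∈ R) :
    ∃ x ∈ X, x ∈ T.verts := by
  by_contra hno
  push Not at hno
  obtain ⟨p⟩ := hT.1.connected.preconnected ⟨u, hT.2 hu⟩ ⟨v, hT.2 hv⟩
  have key : ∀ (a b : T.verts), T.coe.Walk a b → (a : V) ∈ R → (b : V) ∈ R := by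
    intro a b p
    induction p with
    | nil => exact id
    | @cons a b c hadj _ ih =>
      exact fun ha => ih (hR a b ha (fun hb => hno _ hb b.2) (T.adj_sub hadj))
  exact hvR (key _ _ p huR)

/-- The chosen vertex of `X` determines the tree: outside `S` it belongs to one tree only, and
inside `S` its edge to `u` does. -/
theorem localConnectivity_le {V : Type*} {L : SimpleGraph V} {S X : Finset V} {u : V}
    (h : ∀ T : L.Subgraph, IsSteinerTree S T → ∃ x ∈ X, x ∈ T.verts ∧ (x ∉ S ∨ T.Adj u x)) :
    localConnectivity L S ≤ X.card := by
  classical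
  refine csSup_le ⟨0, ∅, by simp⟩ ?_
  rintro m ⟨F, rfl, hF, hd⟩
  have : ∀ T : L.Subgraph, ∃ x, T ∈ F → x ∈ X ∧ x ∈ T.verts ∧ (x ∉ S ∨ T.Adj u x) := by
    intro T
    by_cases hT : T ∈ F
    · obtain ⟨x, hx⟩ := h T (hF T hT)
      exact ⟨x, fun _ => hx⟩
    · exact ⟨u, fun h => absurd h hT⟩
  choose f hf using this
  refine Finset.card_le_card_of_injOn f (fun T hT => (hf T hT).1) ?_
  intro T hT T' hT' he
  by_contra hne
  obtain ⟨-, hv, ho⟩ := hf T hT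
  obtain ⟨-, hv', ho'⟩ := hf T' hT'
  rw [← he] at hv' ho'
  obtain ⟨h₁, h₂⟩ := hd T hT T' hT' hne
  have hS : f T ∈ S := by
    have : f T ∈ T.verts ∩ T'.verts := ⟨hv, hv'⟩
    rw [h₂] at this
    exact this
  have : s(u, f T) ∈ T.edgeSet ∩ T'.edgeSet :=
    ⟨ho.resolve_left (not_not.2 hS), ho'.resolve_left (not_not.2 hS)⟩
  rw [h₁] at this
  exact this

theorem exists_localConnectivity_le_of_cut {V : Type*} [Fintype V] {L : SimpleGraph V}
    {X : Finset V} (h : ¬ (L.induce {v | v ∉ X}).Preconnected) (hV : 3 ≤ Fintype.card V) :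
    ∃ S : Finset V, S.card = 3 ∧ localConnectivity L S ≤ X.card := by
  classical
  obtain ⟨u, v, hu, hv, R, huR, hvR, hR⟩ := exists_closed_of_not_preconnected h
  have huv : u ≠ v := fun h => hvR (h ▸ huR)
  by_cases hw : ∃ w, w ∉ X ∧ w ≠ u ∧ w ≠ v
  · obtain ⟨w, hwX, hwu, hwv⟩ := hw
    refine ⟨{u, v, w}, Finset.card_eq_three.2 ⟨u, v, w, huv, hwu.symm, hwv.symm, rfl⟩,
      localConnectivity_le (u := u) fun T hT => ?_⟩
    obtain ⟨x, hx, hxT⟩ := hT.exists_mem_cut (u := u) (v := v) (by simp) (by simp) huR hvR hR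
    refine ⟨x, hx, hxT, .inl ?_⟩
    simp only [Finset.mem_insert, Finset.mem_singleton, not_or]
    exact ⟨fun h => hu (h ▸ hx), fun h => hv (h ▸ hx), fun h => hwX (h ▸ hx)⟩
  -- Now only `u` and `v` lie outside `X`, so the third vertex must come from `X`. All neighbours of
  -- `u` are in `X`, and each tree is charged to an edge at `u`.
  · push Not at hw
    obtain ⟨w, -, hw'⟩ : ∃ w, w ∈ (Finset.univ : Finset V) ∧ w ∉ ({u, v} : Finset V) := by
      refine Finset.exists_mem_notMem_of_card_lt_card ?_
      rw [Finset.card_pair huv, Finset.card_univ]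
      omega
    simp only [Finset.mem_insert, Finset.mem_singleton, not_or] at hw'
    refine ⟨{u, v, w}, Finset.card_eq_three.2 ⟨u, v, w, huv, Ne.symm hw'.1, Ne.symm hw'.2, rfl⟩,
      localConnectivity_le (u := u) fun T hT => ?_⟩
    obtain ⟨y, hy⟩ := hT.exists_adj (u := u) (v := v) (by simp) (by simp) huv
    refine ⟨y, ?_, T.edge_vert hy.symm, .inr hy⟩
    by_contra hyX
    have hyu : y ≠ u := (T.adj_sub hy).ne.symm
    obtain rfl := hw y hyX hyu
    exact hvR (hR _ _ huR hv (T.adj_sub hy))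

theorem genConnectivity_three_le_of_cut {V : Type*} [Fintype V] {L : SimpleGraph V}
    {X : Finset V} (h : ¬ (L.induce {v | v ∉ X}).Preconnected) (hV : 3 ≤ Fintype.card V) :
    genConnectivity 3 L ≤ X.card := by
  unfold genConnectivity
  by_cases hL : L.Connected
  · rw [if_neg (not_not.2 hL), Nat.card_eq_fintype_card, if_neg (by omega)]
    obtain ⟨S, hS, hle⟩ := exists_localConnectivity_le_of_cut h hV
    exact le_trans (Nat.sInf_le ⟨S, hS, rfl⟩) hle
  · rw [if_pos hL]
    exact Nat.zero_le _

theorem le_genConnectivity {V : Type*} [Fintype V] {L : SimpleGraph V} {k n : ℕ}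
    (hL : L.Connected) (hV : k ≤ Fintype.card V)
    (h : ∀ S : Finset V, S.card = k → n ≤ localConnectivity L S) : n ≤ genConnectivity k L := by
  unfold genConnectivity
  rw [if_neg (not_not.2 hL), Nat.card_eq_fintype_card, if_neg (by omega)]
  obtain ⟨S, -, hS⟩ := Finset.exists_subset_card_eq (s := (Finset.univ : Finset V)) (n := k)
    (by simpa using hV)
  refine le_csInf ⟨_, S, hS, rfl⟩ ?_
  rintro m ⟨S, hS, rfl⟩
  exact h S hS

theorem not_preconnected_lexProd {V W : Type*} [Fintype W] [Nonempty W] {G : SimpleGraph V}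
    (H : SimpleGraph W) {X : Finset V} (h : ¬ (G.induce {v | v ∉ X}).Preconnected) :
    ¬ ((lexProd G H).induce {v | v ∉ X ×ˢ (Finset.univ : Finset W)}).Preconnected := by
  obtain ⟨u, v, hu, hv, R, huR, hvR, hR⟩ := exists_closed_of_not_preconnected h
  obtain ⟨w⟩ := ‹Nonempty W›
  refine not_preconnected_of_closed (u := (u, w)) (v := (v, w)) (by simpa using hu)
    (by simpa using hv) (R := {x | x.1 ∈ R}) huR hvR ?_
  rintro ⟨a, a'⟩ ⟨b, b'⟩ ha hb (hab | ⟨hab, -⟩)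
  · exact hR a b ha (by simpa using hb) hab
  · obtain rfl : a = b := hab
    exact ha

/-- Deleting everything but a non-adjacent pair disconnects with |V| − 2 vertices, fewer than are
needed to leave at most one vertex. -/
theorem exists_cut_card_eq_connectivity {V : Type*} [Fintype V] {G : SimpleGraph V} (hG : G ≠ ⊤) :
    ∃ X : Finset V, X.card = connectivity G ∧ ¬ (G.induce {v | v ∉ X}).Preconnected := by
  classical
  obtain ⟨X, hX, h⟩ := Nat.sInf_mem (s := {k : ℕ | ∃ X : Finset V, X.card = k ∧
    (¬ (G.induce {v | v ∉ X}).Preconnected ∨ {v | v ∉ X}.Subsingleton)})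
    ⟨_, Finset.univ, rfl, .inr (by intro a ha; simp at ha)⟩
  refine ⟨X, hX, h.resolve_right fun hsub => ?_⟩
  rw [SimpleGraph.ne_top_iff_exists_not_adj] at hG
  obtain ⟨u, v, huv, hadj⟩ := hG
  have hcut : ¬ (G.induce {w | w ∉ ({u, v} : Finset V)ᶜ}).Preconnected := by
    refine not_preconnected_of_closed (u := u) (v := v) (by simp) (by simp) (R := {u}) rfl
      (by simpa using huv.symm) ?_
    rintro a b rfl hb hab
    simp only [Finset.mem_compl, not_not, Finset.mem_insert, Finset.mem_singleton] at hb
    rcases hb with rfl | rfl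
    · rfl
    · exact absurd hab hadj
  have h₁ : connectivity G ≤ ({u, v} : Finset V)ᶜ.card := Nat.sInf_le ⟨_, rfl, .inl hcut⟩
  have h₂ : Xᶜ.card ≤ 1 := Finset.card_le_one.2 fun a ha b hb =>
    hsub (by simpa using ha) (by simpa using hb)
  have h₃ : ({u, v} : Finset V).card ≤ Fintype.card V := Finset.card_le_univ _
  rw [Finset.card_compl] at h₁ h₂
  rw [Finset.card_pair huv] at h₁ h₃
  have : X.card = connectivity G := hX
  omega

theorem three_le_card_of_ne_top {V : Type*} [Fintype V] {G : SimpleGraph V} (hG : G ≠ ⊤)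
    (hc : G.Connected) : 3 ≤ Fintype.card V := by
  classical
  rw [SimpleGraph.ne_top_iff_exists_not_adj] at hG
  obtain ⟨u, v, huv, hadj⟩ := hG
  obtain ⟨p⟩ := hc.preconnected u v
  cases p with
  | nil => exact absurd rfl huv
  | @cons _ w _ h _ =>
    have hwv : w ≠ v := fun h' => hadj (h' ▸ h)
    rw [← Finset.card_eq_three.2 ⟨u, v, w, huv, h.ne, hwv.symm, rfl⟩]
    exact Finset.card_le_univ _

/-! ### The inequality, from both bounds in terms of κ(G). -/

theorem le_genConnectivity_three {V : Type*} [Fintype V] {G : SimpleGraph V} (hc : G.Connected)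
    (hV : 3 ≤ Fintype.card V) : (3 * connectivity G + 1) / 4 ≤ genConnectivity 3 G :=
  le_genConnectivity hc hV fun _ hS =>
    (isHighlyConnected_connectivity G).le_localConnectivity hS

theorem le_floor_of_mod_four {k c r : ℕ} (h : (3 * k + 1) / 4 ≤ c) (hr : r < 4)
    (hrk : r ≡ k [MOD 4]) :
    (k : ℤ) ≤ ⌊(4 / 3 : ℚ) * (c : ℚ) + (r : ℚ) - (4 / 3 : ℚ) * (⌈(r : ℚ) / 2⌉ : ℚ)⌋ := by
  rw [Int.le_floor]
  obtain ⟨q, rfl⟩ : ∃ q, k = 4 * q + r := ⟨k / 4, by unfold Nat.ModEq at hrk; omega⟩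
  obtain ⟨d, hd, hdq⟩ : ∃ d : ℕ, ⌈(r : ℚ) / 2⌉ = d ∧ 3 * q + d ≤ c := by
    interval_cases r
    · exact ⟨0, by norm_num, by omega⟩
    · exact ⟨1, by norm_num [Int.ceil_eq_iff], by omega⟩
    · exact ⟨1, by norm_num, by omega⟩
    · exact ⟨2, by norm_num [Int.ceil_eq_iff], by omega⟩
  rw [hd]
  have : (3 * q + d : ℚ) ≤ c := by exact_mod_cast hdq
  push_cast
  linarith

theorem genConnectivity_three_lexProd_le {V W : Type*} [Fintype V] [Fintype W] {G : SimpleGraph V}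
    {H : SimpleGraph W} (hG : G.Connected) (hW : Nonempty W) (hne : G ≠ ⊤) :
    genConnectivity 3 (lexProd G H) ≤ connectivity G * Fintype.card W := by
  obtain ⟨X, hX, hcut⟩ := exists_cut_card_eq_connectivity hne
  have h3 := three_le_card_of_ne_top hne hG
  have hW' : 0 < Fintype.card W := Fintype.card_pos
  have := genConnectivity_three_le_of_cut (not_preconnected_lexProd H hcut)
    (by rw [Fintype.card_prod]; nlinarith)
  rwa [Finset.card_product, hX, Finset.card_univ] at this

theorem genConnectivity_three_lexProd_le_floor {V W : Type*} [Fintype V] [Fintype W]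
    {G : SimpleGraph V} {H : SimpleGraph W} (hG : G.Connected) (hW : Nonempty W) (hne : G ≠ ⊤)
    {r : ℕ} (hr : r < 4) (hrk : r ≡ connectivity G [MOD 4]) :
    (genConnectivity 3 (lexProd G H) : ℤ) ≤
      ⌊(4 / 3 : ℚ) * (genConnectivity 3 G : ℚ) + (r : ℚ)
        - (4 / 3 : ℚ) * (⌈(r : ℚ) / 2⌉ : ℚ)⌋ * (Fintype.card W : ℤ) := by
  have h₁ := genConnectivity_three_lexProd_le (H := H) hG hW hne
  have h₂ := le_floor_of_mod_four
    (le_genConnectivity_three hG (three_le_card_of_ne_top hne hG)) hr hrk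
  calc (genConnectivity 3 (lexProd G H) : ℤ)
      ≤ (connectivity G : ℤ) * (Fintype.card W : ℤ) := by exact_mod_cast h₁
    _ ≤ _ := mul_le_mul_of_nonneg_right h₂ (by positivity)

/-! ### Sharpness: the lexicographic product of a path with the path on three vertices -/

/-- `A` is disjoint from `S` and contains a vertex `c` that is joined to every vertex of `S ∪ A` by
a path of length at most two with inner vertices in `A`. -/
def HubbedBy {V : Type*} (L : SimpleGraph V) (S : Finset V) (A : Set V) : Prop :=
  (∀ v ∈ A, v ∉ S) ∧ ∃ c ∈ A, ∀ v, (v ∈ S ∨ v ∈ A) →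
    v = c ∨ L.Adj v c ∨ ∃ w ∈ A, L.Adj v w ∧ L.Adj w c

theorem HubbedBy.reflTransGen {V : Type*} {L : SimpleGraph V} {S : Finset V} {A : Set V}
    (h : HubbedBy L S A) (D : Set (Sym2 V)) : ∃ c, ∀ v, (v ∈ S ∨ v ∈ A) →
      Relation.ReflTransGen (StepIn L S A D) v c := by
  obtain ⟨hAS, c, hc, h⟩ := h
  have step : ∀ v w, (v ∈ S ∨ v ∈ A) → w ∈ A → L.Adj v w → StepIn L S A D v w :=
    fun v w hv hw hvw => ⟨hvw, hv, .inr hw, fun _ hwS => absurd hwS (hAS w hw)⟩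
  refine ⟨c, fun v hv => ?_⟩
  rcases h v hv with rfl | hvc | ⟨w, hw, hvw, hwc⟩
  · exact .refl
  · exact .single (step v c hv hc hvc)
  · exact (Relation.ReflTransGen.single (step v w hv hw hvw)).tail (step w c (.inr hw) hc hwc)

/-- The first tree is a star on `S` centred at `y`, which takes all edges within `S`; the other two
trees use none. -/
theorem three_le_localConnectivity_of_star {V : Type*} [Finite V] {L : SimpleGraph V} {S : Finset V}
    (hS : S.card = 3) {y : V} (hy : y ∈ S) (hSy : ∀ v ∈ S, v = y ∨ L.Adj v y) {A₁ A₂ : Set V}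
    (hd : Disjoint A₁ A₂) (h₁ : HubbedBy L S A₁) (h₂ : HubbedBy L S A₂) :
    3 ≤ localConnectivity L S := by
  have := card_le_localConnectivity (ι := Fin 3) (G := L) (S := S) (by omega) ![∅, A₁, A₂]
    ![Set.univ, ∅, ∅] ?_ ?_ ?_
  · simpa using this
  · intro i j hij
    fin_cases i <;> fin_cases j <;> first | exact absurd rfl hij | simp [hd, hd.symm]
  · intro i j hij
    fin_cases i <;> fin_cases j <;> first | exact absurd rfl hij | simp
  · intro i
    fin_cases i
    · refine ⟨y, fun v hv => ?_⟩
      have hv : v ∈ S := by simpa using hv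
      rcases hSy v hv with rfl | h
      · exact .refl
      · exact .single ⟨h, .inl hv, .inl hy, fun _ _ => trivial⟩
    · exact h₁.reflTransGen _
    · exact h₂.reflTransGen _

theorem three_le_localConnectivity_of_hubs {V : Type*} [Finite V] {L : SimpleGraph V} {S : Finset V}
    (hS : S.card = 3) (A : Fin 3 → Set V) (hd : Pairwise fun i j => Disjoint (A i) (A j))
    (h : ∀ i, HubbedBy L S (A i)) : 3 ≤ localConnectivity L S := by
  have := card_le_localConnectivity (ι := Fin 3) (G := L) (S := S) (by omega) A (fun _ => ∅) hd
    (fun _ _ _ => by simp) fun i => (h i).reflTransGen _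
  simpa using this

section Lex

variable {V : Type*} [Finite V] {G : SimpleGraph V}

theorem three_le_localConnectivity_of_layer {i h : V} (hih : G.Adj i h) {S : Finset (V × Fin 3)}
    (hS : S.card = 3) (hSi : ∀ v ∈ S, v.1 = i) : 3 ≤ localConnectivity (lexProd G (SimpleGraph.pathGraph 3)) S := by
  refine three_le_localConnectivity_of_hubs hS (fun t => {(h, t)}) (fun t t' htt => ?_)
    fun t => ⟨?_, (h, t), rfl, ?_⟩
  · simpa using htt
  · rintro v rfl hv
    exact hih.ne (hSi _ hv).symm
  · rintro v (hv | rfl)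
    · exact .inr (.inl (.inl (by rw [hSi v hv]; exact hih)))
    · exact .inl rfl

theorem exists_others (t : Fin 3) : ∃ t' t'' : Fin 3, t' ≠ t ∧ t'' ≠ t ∧ t' ≠ t'' := by
  revert t; decide

theorem exists_third (p q : Fin 3) : ∃ t : Fin 3, t ≠ p ∧ t ≠ q := by
  revert p q; decide

theorem exists_adj_pathGraph_three (t : Fin 3) : ∃ t', (SimpleGraph.pathGraph 3).Adj t t' := by
  simp only [SimpleGraph.pathGraph_adj]
  revert t; decide

/-- The hubs are the two other vertices of layer `k`; each reaches `(k, t)` through its own vertex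
of layer `h`. -/
theorem three_le_localConnectivity_of_outer [DecidableEq V] {h i k : V} (hik : G.Adj i k) (hkh : G.Adj k h)
    (hih : i ≠ h) {p q t : Fin 3} (hpq : p ≠ q) :
    3 ≤ localConnectivity (lexProd G (SimpleGraph.pathGraph 3)) {(i, p), (i, q), (k, t)} := by
  obtain ⟨t', t'', ht', ht'', htt⟩ := exists_others t
  refine three_le_localConnectivity_of_star (y := (k, t)) (Finset.card_eq_three.2
    ⟨_, _, _, by simp [hpq], by simp [hik.ne], by simp [hik.ne], rfl⟩) (by simp) ?_
    (A₁ := {(k, t'), (h, 0)}) (A₂ := {(k, t''), (h, 1)}) ?_ ⟨?_, (k, t'), by simp, ?_⟩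
    ⟨?_, (k, t''), by simp, ?_⟩
  · simp [lexProd, hik]
  · rw [Set.disjoint_left]
    rintro v (rfl | rfl) <;> simp [htt, hkh.ne, hkh.ne.symm]
  · rintro v (rfl | rfl) <;> simp [ht', hkh.ne.symm, hik.ne.symm, hih.symm]
  · intro v hv
    simp only [Finset.mem_insert, Finset.mem_singleton, Set.mem_insert_iff,
      Set.mem_singleton_iff] at hv
    rcases hv with (rfl | rfl | rfl) | rfl | rfl <;> simp [lexProd, hik, hkh, hkh.symm]
  · rintro v (rfl | rfl) <;> simp [ht'', hkh.ne.symm, hik.ne.symm, hih.symm]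
  · intro v hv
    simp only [Finset.mem_insert, Finset.mem_singleton, Set.mem_insert_iff,
      Set.mem_singleton_iff] at hv
    rcases hv with (rfl | rfl | rfl) | rfl | rfl <;> simp [lexProd, hik, hkh, hkh.symm]

/-- This serves when `k` is an end of the path. One hub lies in layer `h` and reaches `(k, t)`
through the free vertex of layer `i`; the other is a neighbour of `(k, t)` in its own layer, the
point where edges of P₃ are needed. -/
theorem three_le_localConnectivity_of_inner [DecidableEq V] {h i k : V} (hik : G.Adj i k) (hhi : G.Adj h i)
    (hkh : k ≠ h) {p q t : Fin 3} (hpq : p ≠ q) :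
    3 ≤ localConnectivity (lexProd G (SimpleGraph.pathGraph 3)) {(i, p), (i, q), (k, t)} := by
  obtain ⟨s, hsp, hsq⟩ := exists_third p q
  obtain ⟨t', ht'⟩ := exists_adj_pathGraph_three t
  refine three_le_localConnectivity_of_star (y := (k, t)) (Finset.card_eq_three.2
    ⟨_, _, _, by simp [hpq], by simp [hik.ne], by simp [hik.ne], rfl⟩) (by simp) ?_
    (A₁ := {(i, s), (h, 0)}) (A₂ := {(k, t')}) ?_ ⟨?_, (h, 0), by simp, ?_⟩
    ⟨?_, (k, t'), by simp, ?_⟩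
  · simp [lexProd, hik]
  · rw [Set.disjoint_left]
    rintro v (rfl | rfl) <;> simp [hik.ne, hkh.symm]
  · rintro v (rfl | rfl) <;> simp [hsp, hsq, hik.ne, hhi.ne, hkh.symm]
  · intro v hv
    simp only [Finset.mem_insert, Finset.mem_singleton, Set.mem_insert_iff,
      Set.mem_singleton_iff] at hv
    rcases hv with (rfl | rfl | rfl) | rfl | rfl <;> simp [lexProd, hik.symm, hhi, hhi.symm]
  · rintro v rfl
    simp [ht'.ne.symm, hik.ne.symm]
  · intro v hv
    simp only [Finset.mem_insert, Finset.mem_singleton, Set.mem_singleton_iff] at hv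
    rcases hv with (rfl | rfl | rfl) | rfl <;> simp [lexProd, hik, ht']

/-- The hubs are the two other vertices of the middle layer; they reach `(j, q)` through layers `i`
and `k` respectively. -/
theorem three_le_localConnectivity_of_consecutive [DecidableEq V] {i j k : V} (hij : G.Adj i j) (hjk : G.Adj j k)
    (hik : i ≠ k) {p q r : Fin 3} :
    3 ≤ localConnectivity (lexProd G (SimpleGraph.pathGraph 3)) {(i, p), (j, q), (k, r)} := by
  obtain ⟨q', q'', hq', hq'', hqq⟩ := exists_others q
  obtain ⟨p', hp', -⟩ := exists_third p p
  obtain ⟨r', hr', -⟩ := exists_third r r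
  refine three_le_localConnectivity_of_star (y := (j, q)) (Finset.card_eq_three.2
    ⟨_, _, _, by simp [hij.ne], by simp [hik], by simp [hjk.ne], rfl⟩) (by simp) ?_
    (A₁ := {(j, q'), (i, p')}) (A₂ := {(j, q''), (k, r')}) ?_ ⟨?_, (j, q'), by simp, ?_⟩
    ⟨?_, (j, q''), by simp, ?_⟩
  · simp [lexProd, hij, hjk.symm]
  · rw [Set.disjoint_left]
    rintro v (rfl | rfl) <;> simp [hqq, hjk.ne, hij.ne, hik]
  · rintro v (rfl | rfl) <;> simp [hq', hp', hjk.ne, hij.ne, hij.ne.symm, hik]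
  · intro v hv
    simp only [Finset.mem_insert, Finset.mem_singleton, Set.mem_insert_iff,
      Set.mem_singleton_iff] at hv
    rcases hv with (rfl | rfl | rfl) | rfl | rfl <;> simp [lexProd, hij, hij.symm, hjk.symm]
  · rintro v (rfl | rfl) <;> simp [hq'', hr', hjk.ne, hjk.ne.symm, hij.ne.symm, hik.symm]
  · intro v hv
    simp only [Finset.mem_insert, Finset.mem_singleton, Set.mem_insert_iff,
      Set.mem_singleton_iff] at hv
    rcases hv with (rfl | rfl | rfl) | rfl | rfl <;> simp [lexProd, hij, hjk, hjk.symm]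

end Lex

/-- Each of the three rows, restricted to the layers strictly between those of `x` and `z`, is a
path carrying one tree. The last hypothesis ensures that `y` also has a neighbouring layer in that
range. -/
theorem three_le_localConnectivity_of_far {n : ℕ} {x y z : Fin n × Fin 3}
    (hS : ({x, y, z} : Finset (Fin n × Fin 3)).card = 3) (hxy : x.1 ≤ y.1) (hyz : y.1 ≤ z.1)
    (hxz : (x.1 : ℕ) + 2 ≤ z.1)
    (h : (x.1 : ℕ) + 2 = z.1 → x.1 = y.1 ∨ y.1 = z.1) :
    3 ≤ localConnectivity (lexProd (SimpleGraph.pathGraph n) (SimpleGraph.pathGraph 3))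
      {x, y, z} := by
  rw [Fin.le_def] at hxy hyz
  simp only [Fin.ext_iff] at h
  have hz := z.1.2
  set L := lexProd (SimpleGraph.pathGraph n) (SimpleGraph.pathGraph 3) with hL
  set S : Finset (Fin n × Fin 3) := {x, y, z} with hSdef
  let A : Fin 3 → Set (Fin n × Fin 3) := fun t => {v | x.1 < v.1 ∧ v.1 < z.1 ∧ v.2 = t}
  let D : Fin 3 → Set (Sym2 (Fin n × Fin 3)) := fun t => {_e | y.2 = t}
  have hAS : ∀ t, ∀ v ∈ A t, v ∈ S → y.2 = t := by
    rintro t v ⟨h₁, h₂, rfl⟩ hv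
    simp only [hSdef, Finset.mem_insert, Finset.mem_singleton] at hv
    rcases hv with rfl | rfl | rfl
    · exact absurd h₁ (lt_irrefl _)
    · rfl
    · exact absurd h₂ (lt_irrefl _)
  have hstep : ∀ t v w, (v ∈ S ∨ v ∈ A t) → w ∈ A t →
      ((v.1 : ℕ) + 1 = w.1 ∨ (w.1 : ℕ) + 1 = v.1) → StepIn L S (A t) (D t) v w :=
    fun t v w hv hw hvw => ⟨.inl (SimpleGraph.pathGraph_adj.2 hvw), hv, .inr hw,
      fun _ hwS => hAS t w hw hwS⟩
  have key := card_le_localConnectivity (ι := Fin 3) (G := L) (S := S) (by omega) A D ?_ ?_ ?_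
  · simpa using key
  · intro t t' htt
    rw [Set.disjoint_left]
    rintro v ⟨-, -, rfl⟩ ⟨-, -, h'⟩
    exact htt h'
  · intro t t' htt
    rw [Set.disjoint_left]
    rintro e rfl h'
    exact htt h'
  · intro t
    have hc : (x.1 : ℕ) + 1 < n := by omega
    refine ⟨(⟨x.1 + 1, hc⟩, t), ?_⟩
    have hcol : ∀ l : ℕ, (x.1 : ℕ) < l → ∀ hlz : l < z.1, Relation.ReflTransGen
        (StepIn L S (A t) (D t)) (⟨l, hlz.trans hz⟩, t) (⟨x.1 + 1, hc⟩, t) := by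
      intro l hl
      induction l, hl using Nat.le_induction with
      | base => exact fun _ => .refl
      | succ l hl ih =>
        intro hlz
        refine .head (hstep t _ (⟨l, by omega⟩, t) (.inr ⟨?_, ?_, rfl⟩) ⟨?_, ?_, rfl⟩ (.inr rfl))
          (ih (by omega)) <;> rw [Fin.lt_def] <;> simp <;> omega
    have hvia : ∀ v ∈ S, ∀ l : ℕ, (x.1 : ℕ) < l → l < z.1 →
        ((v.1 : ℕ) + 1 = l ∨ l + 1 = v.1) →
        Relation.ReflTransGen (StepIn L S (A t) (D t)) v (⟨x.1 + 1, hc⟩, t) := by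
      intro v hv l hl hlz hvl
      exact .head (hstep t v (⟨l, hlz.trans hz⟩, t) (.inl hv) ⟨hl, hlz, rfl⟩ hvl) (hcol l hl hlz)
    rintro v (hv | ⟨h₁, h₂, rfl⟩)
    · have hv' := hv
      simp only [hSdef, Finset.mem_insert, Finset.mem_singleton] at hv'
      rcases hv' with rfl | rfl | rfl
      · exact hvia _ hv (v.1 + 1) (by omega) (by omega) (.inl rfl)
      · by_cases hlt : (v.1 : ℕ) + 1 < z.1
        · exact hvia _ hv (v.1 + 1) (by omega) hlt (.inl rfl)
        · exact hvia _ hv (v.1 - 1) (by omega) (by omega) (.inr (by omega))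
      · exact hvia _ hv (v.1 - 1) (by omega) (by omega) (.inr (by omega))
    · exact hcol v.1 h₁ h₂

theorem exists_sorted_triple {n : ℕ} {S : Finset (Fin n × Fin 3)} (hS : S.card = 3) :
    ∃ x y z, S = {x, y, z} ∧ x ≠ y ∧ x ≠ z ∧ y ≠ z ∧ x.1 ≤ y.1 ∧ y.1 ≤ z.1 := by
  obtain ⟨a, b, c, hab, hac, hbc, rfl⟩ := Finset.card_eq_three.1 hS
  have swap₁ : ∀ x y z : Fin n × Fin 3, ({x, y, z} : Finset _) = {y, x, z} := fun x y z =>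
    Finset.insert_comm _ _ _
  have swap₂ : ∀ x y z : Fin n × Fin 3, ({x, y, z} : Finset _) = {x, z, y} := fun x y z => by
    rw [Finset.pair_comm]
  rcases le_total a.1 b.1 with h₁ | h₁ <;> rcases le_total b.1 c.1 with h₂ | h₂ <;>
    rcases le_total a.1 c.1 with h₃ | h₃
  · exact ⟨a, b, c, rfl, hab, hac, hbc, h₁, h₂⟩
  · exact ⟨a, b, c, rfl, hab, hac, hbc, h₁, h₂⟩
  · exact ⟨a, c, b, swap₂ _ _ _, hac, hab, hbc.symm, h₃, h₂⟩
  · exact ⟨c, a, b, by rw [swap₂, swap₁], hac.symm, hbc.symm, hab, h₃, h₁⟩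
  · exact ⟨b, a, c, swap₁ _ _ _, hab.symm, hbc, hac, h₁, h₃⟩
  · exact ⟨b, c, a, by rw [swap₁, swap₂], hbc, hab.symm, hac.symm, h₂, h₃⟩
  · exact ⟨c, b, a, by rw [swap₁, swap₂, swap₁], hbc.symm, hac.symm, hab.symm, h₂, h₁⟩
  · exact ⟨c, b, a, by rw [swap₁, swap₂, swap₁], hbc.symm, hac.symm, hab.symm, h₂, h₁⟩

theorem three_le_localConnectivity_lexProd_pathGraph {n : ℕ} (hn : 3 ≤ n)
    {S : Finset (Fin n × Fin 3)} (hS : S.card = 3) :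
    3 ≤ localConnectivity (lexProd (SimpleGraph.pathGraph n) (SimpleGraph.pathGraph 3)) S := by
  obtain ⟨⟨i, p⟩, ⟨j, q⟩, ⟨k, r⟩, rfl, hxy, hxz, hyz, hij, hjk⟩ := exists_sorted_triple hS
  have adj : ∀ a b : Fin n, (a : ℕ) + 1 = b → (SimpleGraph.pathGraph n).Adj a b := fun a b h =>
    SimpleGraph.pathGraph_adj.2 (.inl h)
  have hin := i.2
  have hkn := k.2
  by_cases hfar : (i : ℕ) + 2 ≤ k ∧ ((i : ℕ) + 2 = k → i = j ∨ j = k)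
  · exact three_le_localConnectivity_of_far hS hij hjk hfar.1 hfar.2
  change i ≤ j at hij
  change j ≤ k at hjk
  rw [Fin.le_def] at hij hjk
  simp only [Fin.ext_iff] at hfar
  by_cases hcons : (i : ℕ) + 1 = j ∧ (j : ℕ) + 1 = k
  · exact three_le_localConnectivity_of_consecutive (adj i j hcons.1) (adj j k hcons.2)
      (by rw [ne_eq, Fin.ext_iff]; omega)
  -- What remains occupies one layer or two adjacent ones. In the second case the extra layer is
  -- taken beyond `k` or before `i`, one of which exists since `n ≥ 3`.
  have hor : (i = j ∧ j = k) ∨ (i = j ∧ (j : ℕ) + 1 = k) ∨ ((i : ℕ) + 1 = j ∧ j = k) := by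
    simp only [Fin.ext_iff]
    omega
  rcases hor with ⟨rfl, rfl⟩ | ⟨rfl, h⟩ | ⟨h, rfl⟩
  · obtain ⟨h, hh⟩ : ∃ h, (SimpleGraph.pathGraph n).Adj i h := by
      by_cases hlt : (i : ℕ) + 1 < n
      · exact ⟨⟨i + 1, hlt⟩, adj _ _ rfl⟩
      · exact ⟨⟨i - 1, by omega⟩, (adj _ _ (by simp; omega)).symm⟩
    exact three_le_localConnectivity_of_layer hh hS (by simp)
  · have hpq : p ≠ q := fun h => hxy (by rw [h])
    by_cases hlt : (k : ℕ) + 1 < n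
    · exact three_le_localConnectivity_of_outer (adj i k h) (adj k ⟨k + 1, hlt⟩ rfl)
        (by rw [ne_eq, Fin.ext_iff]; simp; omega) hpq
    · exact three_le_localConnectivity_of_inner (h := ⟨i - 1, by omega⟩) (adj i k h)
        (adj _ _ (by simp; omega)) (by rw [ne_eq, Fin.ext_iff]; simp; omega) hpq
  · have hqr : q ≠ r := fun h => hyz (by rw [h])
    have hset : ({(i, p), (j, q), (j, r)} : Finset (Fin n × Fin 3)) = {(j, q), (j, r), (i, p)} := by
      rw [Finset.insert_comm, Finset.pair_comm (i, p)]
    rw [hset]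
    by_cases hlt : (j : ℕ) + 1 < n
    · exact three_le_localConnectivity_of_inner (h := ⟨j + 1, hlt⟩) (adj i j h).symm
        (adj j _ rfl).symm (by rw [ne_eq, Fin.ext_iff]; simp; omega) hqr
    · exact three_le_localConnectivity_of_outer (h := ⟨i - 1, by omega⟩) (adj i j h).symm
        (adj _ _ (by simp; omega)).symm (by rw [ne_eq, Fin.ext_iff]; simp; omega) hqr

/-! ### The parameters of Pₙ and Pₙ ∘ P₃. -/

theorem pathGraph_connected_of_pos {n : ℕ} (hn : 0 < n) : (SimpleGraph.pathGraph n).Connected := by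
  obtain ⟨n, rfl⟩ : ∃ k, n = k + 1 := ⟨n - 1, by omega⟩
  exact SimpleGraph.pathGraph_connected n

theorem pathGraph_ne_top {n : ℕ} (hn : 3 ≤ n) : SimpleGraph.pathGraph n ≠ ⊤ := by
  rw [SimpleGraph.ne_top_iff_exists_not_adj]
  refine ⟨⟨0, by omega⟩, ⟨2, by omega⟩, by simp, ?_⟩
  simp [SimpleGraph.pathGraph_adj]

theorem not_preconnected_pathGraph {n : ℕ} (hn : 3 ≤ n) :
    ¬ ((SimpleGraph.pathGraph n).induce
      {v | v ∉ ({⟨1, by omega⟩} : Finset (Fin n))}).Preconnected := by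
  refine not_preconnected_of_closed (u := ⟨0, by omega⟩) (v := ⟨2, by omega⟩) (by simp) (by simp)
    (R := {⟨0, by omega⟩}) rfl
    (by rw [Set.mem_singleton_iff, Fin.ext_iff]; simp) ?_
  rintro a b rfl hb hab
  simp only [SimpleGraph.pathGraph_adj, Finset.mem_singleton, Fin.ext_iff] at hab hb
  omega

theorem one_le_connectivity {V : Type*} [Fintype V] [Nontrivial V] {G : SimpleGraph V}
    (hG : G.Connected) (hne : G ≠ ⊤) : 1 ≤ connectivity G := by
  obtain ⟨X, hX, h⟩ := exists_cut_card_eq_connectivity hne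
  by_contra hlt
  have hX0 : X = ∅ := Finset.card_eq_zero.1 (by omega)
  subst hX0
  obtain ⟨u, v, -, -, R, huR, hvR, hR⟩ := exists_closed_of_not_preconnected h
  obtain ⟨p⟩ := hG.preconnected u v
  have key : ∀ a b, G.Walk a b → a ∈ R → b ∈ R := by
    intro a b p
    induction p with
    | nil => exact id
    | cons hadj _ ih => exact fun ha => ih (hR _ _ ha (by simp) hadj)
  exact hvR (key _ _ p huR)

theorem connectivity_pathGraph {n : ℕ} (hn : 3 ≤ n) :
    connectivity (SimpleGraph.pathGraph n) = 1 := by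
  have : Nontrivial (Fin n) := Fin.nontrivial_iff_two_le.2 (by omega)
  refine le_antisymm (Nat.sInf_le ⟨_, Finset.card_singleton _,
    .inl (not_preconnected_pathGraph hn)⟩) ?_
  exact one_le_connectivity (pathGraph_connected_of_pos (by omega)) (pathGraph_ne_top hn)

theorem genConnectivity_three_pathGraph {n : ℕ} (hn : 3 ≤ n) :
    genConnectivity 3 (SimpleGraph.pathGraph n) = 1 := by
  have hc : 3 ≤ Fintype.card (Fin n) := by simpa using hn
  refine le_antisymm ?_ ?_
  · simpa using genConnectivity_three_le_of_cut (not_preconnected_pathGraph hn) hc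
  · have := le_genConnectivity_three (pathGraph_connected_of_pos (n := n) (by omega)) hc
    rwa [connectivity_pathGraph hn] at this

theorem lexProd_connected {V W : Type*} {G : SimpleGraph V} {H : SimpleGraph W} (hG : G.Connected)
    (hH : H.Connected) : (lexProd G H).Connected := by
  obtain ⟨v⟩ := hG.nonempty
  obtain ⟨w⟩ := hH.nonempty
  have : Nonempty (V × W) := ⟨(v, w)⟩
  have h₁ : ∀ a b c, (lexProd G H).Reachable (a, c) (b, c) := fun a b c => by
    obtain ⟨p⟩ := hG.preconnected a b
    induction p with
    | nil => exact .refl _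
    | @cons a b _ h _ ih =>
      have h' : (lexProd G H).Adj (a, c) (b, c) := .inl h
      exact h'.reachable.trans ih
  have h₂ : ∀ a c d, (lexProd G H).Reachable (a, c) (a, d) := fun a c d => by
    obtain ⟨p⟩ := hH.preconnected c d
    induction p with
    | nil => exact .refl _
    | @cons c d _ h _ ih =>
      have h' : (lexProd G H).Adj (a, c) (a, d) := .inr ⟨rfl, h⟩
      exact h'.reachable.trans ih
  exact ⟨fun x y => (h₁ x.1 y.1 x.2).trans (h₂ y.1 x.2 y.2)⟩

theorem genConnectivity_three_lexProd_pathGraph {n : ℕ} (hn : 3 ≤ n) :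
    genConnectivity 3 (lexProd (SimpleGraph.pathGraph n) (SimpleGraph.pathGraph 3)) = 3 := by
  have hP := pathGraph_connected_of_pos (n := n) (by omega)
  refine le_antisymm ?_ (le_genConnectivity
    (lexProd_connected hP (pathGraph_connected_of_pos (by omega))) ?_
    fun S hS => three_le_localConnectivity_lexProd_pathGraph hn hS)
  · have := genConnectivity_three_lexProd_le (H := SimpleGraph.pathGraph 3) hP inferInstance
      (pathGraph_ne_top hn)
    simpa [connectivity_pathGraph hn] using this
  · simp only [Fintype.card_prod, Fintype.card_fin]
    omega

end GenConn

theorem theorem1p10 :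
    (∀ (V W : Type*) [Fintype V] [Fintype W] (G : SimpleGraph V) (H : SimpleGraph W),
      G.Connected → H.Connected → Nontrivial V → G ≠ ⊤ →
      ∀ r : ℕ, r < 4 → r ≡ GenConn.connectivity G [MOD 4] →
        (GenConn.genConnectivity 3 (GenConn.lexProd G H) : ℤ) ≤
          ⌊(4 / 3 : ℚ) * (GenConn.genConnectivity 3 G : ℚ) + (r : ℚ)
            - (4 / 3 : ℚ) * (⌈(r : ℚ) / 2⌉ : ℚ)⌋ * (Fintype.card W : ℤ)) ∧
    (∀ n : ℕ, 4 ≤ n →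
      (SimpleGraph.pathGraph n).Connected ∧ (SimpleGraph.pathGraph 3).Connected ∧
      SimpleGraph.pathGraph n ≠ ⊤ ∧
      ∀ r : ℕ, r < 4 → r ≡ GenConn.connectivity (SimpleGraph.pathGraph n) [MOD 4] →
        (GenConn.genConnectivity 3
            (GenConn.lexProd (SimpleGraph.pathGraph n) (SimpleGraph.pathGraph 3)) : ℤ) =
          ⌊(4 / 3 : ℚ) * (GenConn.genConnectivity 3 (SimpleGraph.pathGraph n) : ℚ) + (r : ℚ)
            - (4 / 3 : ℚ) * (⌈(r : ℚ) / 2⌉ : ℚ)⌋ * (Fintype.card (Fin 3) : ℤ)) := by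
  refine ⟨fun V W _ _ G H hG hH _ hne r hr hrk =>
    GenConn.genConnectivity_three_lexProd_le_floor hG hH.nonempty hne hr hrk, fun n hn => ?_⟩
  have hn' : 3 ≤ n := by omega
  refine ⟨GenConn.pathGraph_connected_of_pos (by omega), GenConn.pathGraph_connected_of_pos (by omega),
    GenConn.pathGraph_ne_top hn', fun r hr hrk => ?_⟩
  rw [GenConn.connectivity_pathGraph hn'] at hrk
  -- Since κ(Pₙ) = 1, the residue is 1 and the floor is ⌊4/3 + 1 − 4/3⌋ = 1.
  obtain rfl : r = 1 := by
    unfold Nat.ModEq at hrk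
    omega
  have hceil : ⌈((1 : ℕ) : ℚ) / 2⌉ = 1 := by norm_num [Int.ceil_eq_iff]
  rw [GenConn.genConnectivity_three_lexProd_pathGraph hn',
    GenConn.genConnectivity_three_pathGraph hn', hceil]
  norm_num
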